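/- Let $n\ge 2$ be an integer and let $\mathcal D_n$ be the dihedral group of order $2n$ acting on $\mathbb R^2\cong\mathbb C$: with $w=e^{i\pi/n}$, its elements are the rotations $z\mapsto z\,w^{2j}$ and the reflections $z\mapsto \overline z\,w^{2j}$, $0\le j\le n-1$, and $R_+=\{i w^{j}: 0\le j\le n-1\}$ is a set of positive roots. Let $k\in\mathbb C$, put $\gamma:=nk$, and assume that $\gamma\notin\{-\tfrac m2 : m=1,2,3,\dots\}$. For $\xi\in\mathbb R^2$ let $$T_\xi f(x)=\partial_\xi f(x)+k\sum_{\alpha\in R_+}\langle\alpha,\xi\rangle\,\frac{f(x)-f(\sigma_\alpha x)}{\langle\alpha,x\rangle},\qquad \sigma_\alpha x=x-\frac{2\langle x,\alpha\rangle}{|\alpha|^2}\alpha,$$ be the Dunkl operators (the quotient being extended by continuity to $\langle\alpha,x\rangle=0$). Then there is a unique linear automorphism $V_k$ of the space of complex polynomials on $\mathbb R^2$ that maps homogeneous polynomials of degree $m$ to homogeneous polynomials of degree $m$ for every $m\ge 0$ and satisfies $V_k(1)=1$ and $T_\xi V_k=V_k\partial_\xi$ for all $\xi\in\mathbb R^2$.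 Write $\langle x,y\rangle=x_1y_1+x_2y_2$ for $x\in\mathbb R^2$, $y\in\mathbb C^2$, and let $$E_m(x,y)=\frac1{m!}V_k\big(\langle\cdot,y\rangle^m\big)(x),\qquad a(x,y)=\max_{g\in\mathcal D_n}|\langle gx,y\rangle| .$$ If $\nu$ is a nonnegative integer with $\mathrm{Re}(\gamma)>-\nu$, then there exist a constant $\delta\ge 1$ and a constant $C=C(n,k,\nu)>0$ such that $$|E_m(x,y)|\le C\,\frac{m^{\nu+2}}{m!}\,\big(\delta\,a(x,y)\big)^m$$ for all integers $m\ge 1$, all $x\in\mathbb R^2$ and all $y\in\mathbb C^2$. -/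

import Mathlib

namespace DunklDihedral

noncomputable section

/-- The reflection `σ_α x = x - 2 ⟨x, α⟩ α / |α|²` of `ℝ^d`. -/
def rootReflection {d : ℕ} (α x : EuclideanSpace ℝ (Fin d)) : EuclideanSpace ℝ (Fin d) :=
  x - (2 * inner ℝ x α / ‖α‖ ^ 2) • α

/-- The difference quotient `(f x - f (σ_α x)) / ⟨α, x⟩`. On the hyperplane `⟨α, x⟩ = 0` it is
given its limit value `(2 / |α|²) ∂_α f (x)`, which makes it continuous for `f` of class `C¹`. -/
def reflectionQuotient {d : ℕ} (α : EuclideanSpace ℝ (Fin d))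
    (f : EuclideanSpace ℝ (Fin d) → ℂ) (x : EuclideanSpace ℝ (Fin d)) : ℂ :=
  open Classical in
  if inner ℝ α x = 0 then ((2 / ‖α‖ ^ 2 : ℝ) : ℂ) * fderiv ℝ f x α
  else (f x - f (rootReflection α x)) / ((inner ℝ α x : ℝ) : ℂ)

/-- The Dunkl operator `T_ξ` on `ℝ^d` for the finite family `α` of positive roots and the
parameter function `k`. -/
def dunklOp {d : ℕ} {ι : Type*} [Fintype ι] (α : ι → EuclideanSpace ℝ (Fin d)) (k : ι → ℂ)
    (ξ : EuclideanSpace ℝ (Fin d)) (f : EuclideanSpace ℝ (Fin d) → ℂ)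
    (x : EuclideanSpace ℝ (Fin d)) : ℂ :=
  fderiv ℝ f x ξ +
    ∑ i, k i * ((inner ℝ (α i) ξ : ℝ) : ℂ) * reflectionQuotient (α i) f x

/-- The polynomial function on `ℝ^d` given by a complex polynomial. -/
def polyFun {d : ℕ} (p : MvPolynomial (Fin d) ℂ) (x : EuclideanSpace ℝ (Fin d)) : ℂ :=
  MvPolynomial.eval (fun i => ((x i : ℝ) : ℂ)) p

/-- The directional derivative `∂_ξ` on polynomials. -/
def polyDeriv {d : ℕ} (ξ : EuclideanSpace ℝ (Fin d)) (p : MvPolynomial (Fin d) ℂ) :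
    MvPolynomial (Fin d) ℂ :=
  ∑ i, MvPolynomial.C ((ξ i : ℝ) : ℂ) * MvPolynomial.pderiv i p

/-- `V` is an intertwining operator for the Dunkl operators: a linear automorphism of the space
of polynomials which preserves homogeneous degrees, fixes `1` and satisfies `T_ξ V = V ∂_ξ`. -/
structure IsIntertwining {d : ℕ} {ι : Type*} [Fintype ι] (α : ι → EuclideanSpace ℝ (Fin d))
    (k : ι → ℂ) (V : MvPolynomial (Fin d) ℂ ≃ₗ[ℂ] MvPolynomial (Fin d) ℂ) : Prop where
  homogeneous : ∀ (m : ℕ) (p : MvPolynomial (Fin d) ℂ), p.IsHomogeneous m →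
    (V p).IsHomogeneous m
  map_one : V 1 = 1
  intertwines : ∀ (ξ : EuclideanSpace ℝ (Fin d)) (p : MvPolynomial (Fin d) ℂ)
    (x : EuclideanSpace ℝ (Fin d)),
    dunklOp α k ξ (polyFun (V p)) x = polyFun (V (polyDeriv ξ p)) x

/-- The bilinear form `⟨x, y⟩ = ∑ i, x_i y_i` for `x ∈ ℝ^d` and `y ∈ ℂ^d`. -/
def pairing {d : ℕ} (x : EuclideanSpace ℝ (Fin d)) (y : EuclideanSpace ℂ (Fin d)) : ℂ :=
  ∑ i, ((x i : ℝ) : ℂ) * y i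

/-- The linear form `⟨·, y⟩` as a polynomial. -/
def pairingPoly {d : ℕ} (y : EuclideanSpace ℂ (Fin d)) : MvPolynomial (Fin d) ℂ :=
  ∑ i, MvPolynomial.X i * MvPolynomial.C (y i)

/-- The homogeneous component `E_m(x, y) = (1 / m!) V(⟨·, y⟩ ^ m)(x)` of the Dunkl kernel
attached to the intertwining operator `V`. -/
def dunklComponent {d : ℕ} (V : MvPolynomial (Fin d) ℂ ≃ₗ[ℂ] MvPolynomial (Fin d) ℂ) (m : ℕ)
    (x : EuclideanSpace ℝ (Fin d)) (y : EuclideanSpace ℂ (Fin d)) : ℂ :=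
  1 / (m.factorial : ℂ) * polyFun (V (pairingPoly y ^ m)) x

/-- The positive roots `i w ^ j`, `w = exp (i π / n)`, `0 ≤ j < n`, of the dihedral group of
order `2 n`, with `ℂ` identified with `ℝ²`. -/
def dihedralRoot (n : ℕ) (j : Fin n) : EuclideanSpace ℝ (Fin 2) :=
  !₂[-Real.sin (Real.pi * (j : ℕ) / n), Real.cos (Real.pi * (j : ℕ) / n)]

/-- The elements of the dihedral group of order `2 n`: the rotations `z ↦ z w ^ (2 j)` (left
summand) and the reflections `z ↦ conj z * w ^ (2 j)` (right summand), `0 ≤ j < n`, with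
`w = exp (i π / n)` and `ℂ` identified with `ℝ²`. -/
def dihedralMap (n : ℕ) (g : Fin n ⊕ Fin n) (x : EuclideanSpace ℝ (Fin 2)) :
    EuclideanSpace ℝ (Fin 2) :=
  match g with
  | .inl j =>
    !₂[Real.cos (2 * Real.pi * (j : ℕ) / n) * x 0 - Real.sin (2 * Real.pi * (j : ℕ) / n) * x 1,
      Real.sin (2 * Real.pi * (j : ℕ) / n) * x 0 + Real.cos (2 * Real.pi * (j : ℕ) / n) * x 1]
  | .inr j =>
    !₂[Real.cos (2 * Real.pi * (j : ℕ) / n) * x 0 + Real.sin (2 * Real.pi * (j : ℕ) / n) * x 1,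
      Real.sin (2 * Real.pi * (j : ℕ) / n) * x 0 - Real.cos (2 * Real.pi * (j : ℕ) / n) * x 1]

/-- `a(x, y)`, the maximum of `|⟨g x, y⟩|` over the dihedral group of order `2 n`
(a finite supremum). -/
def dihedralMax (n : ℕ) (x : EuclideanSpace ℝ (Fin 2)) (y : EuclideanSpace ℂ (Fin 2)) : ℝ :=
  ⨆ g : Fin n ⊕ Fin n, ‖pairing (dihedralMap n g x) y‖

end

end DunklDihedral

open MvPolynomial

namespace DunklDihedral

noncomputable section

/-! Everything rests on one Euler identity. Contracting the Dunkl gradient with `x` cancels the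
denominators `⟨α, x⟩`, so on homogeneous polynomials of degree `m` the operator `∑ x_i T_i` is `(m +
γ) - k S`, with `S` the sum of the `n` reflections (`sum_X_mul_dunklPoly`). In the dihedral group
`S³ = n² S`, so the only possible eigenvalues of `S` are `0, n, -n`, and `(m + γ) - k S` acts on the
corresponding eigenspaces by `m + γ`, `m`, `m + 2γ`. The excluded values of `γ` are exactly those
that make one of these vanish for some `m ≥ 1`, and the inverse `shiftInv` is explicit.

An intertwiner must satisfy `((m + γ) - k S) V p = ∑ x_i V(∂_i p)`. This determines `V` degree by
degree, which gives uniqueness, and serves as its definition. That the result intertwines follows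
from `dunklPoly_eq_of_euler`, where the same inversion is applied to vector fields.

For `p = ⟨·, y⟩^m` the recursion is `V(⟨·, y⟩^m) = m ((m + γ) - k S)⁻¹ (⟨·, y⟩ V(⟨·, y⟩^(m-1)))`. In
the supremum norm on the orbit of `x`, multiplication by `⟨·, y⟩` costs at most `a(x, y)`, and `m
((m + γ) - k S)⁻¹` costs at most `shiftBound`, which tends to `1`. The product of these bounds is
therefore at most a constant times `2^m`. -/

/-- The linear form `∑ i, v i * X i`. -/
def linForm {d : ℕ} (v : Fin d → ℂ) : MvPolynomial (Fin d) ℂ := ∑ i, C (v i) * X i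

/-- The reflection of `u` in the hyperplane orthogonal to the unit vector `v`. -/
def reflVec {d : ℕ} (v u : Fin d → ℂ) : Fin d → ℂ := fun i => u i - 2 * (v ⬝ᵥ u) * v i

/-- The algebra homomorphism `p ↦ p ∘ σ_v`, for a unit vector `v`. -/
def reflHom {d : ℕ} (v : Fin d → ℂ) : MvPolynomial (Fin d) ℂ →ₐ[ℂ] MvPolynomial (Fin d) ℂ :=
  aeval (fun i => X i - C (2 * v i) * linForm v)

/-! ### Reflections and divided differences on polynomials -/

section General

variable {d : ℕ} (v : Fin d → ℂ)

@[simp] lemma reflHom_X (i : Fin d) : reflHom v (X i) = X i - C (2 * v i) * linForm v := by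
  simp [reflHom]

@[simp] lemma reflHom_C (c : ℂ) : reflHom v (C c) = C c := by
  simp [reflHom, ← algebraMap_eq]

lemma linForm_neg : linForm (-v) = -linForm v := by
  simp [linForm]

lemma linForm_sub (u w : Fin d → ℂ) (c : ℂ) :
    linForm (fun i => u i - c * w i) = linForm u - C c * linForm w := by
  simp only [linForm, Finset.mul_sum, ← Finset.sum_sub_distrib]
  refine Finset.sum_congr rfl fun i _ => ?_
  simp only [C_sub, C_mul]
  ring

lemma reflHom_neg : reflHom (-v) = reflHom v := by
  ext1 i
  simp [linForm_neg]

lemma reflHom_linForm (u : Fin d → ℂ) : reflHom v (linForm u) = linForm (reflVec v u) := by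
  unfold reflVec
  rw [linForm_sub, linForm, map_sum]
  have h : C (2 * (v ⬝ᵥ u)) * linForm v = ∑ i, C (u i) * (C (2 * v i) * linForm v) := by
    simp only [dotProduct, Finset.mul_sum, map_sum, Finset.sum_mul]
    refine Finset.sum_congr rfl fun i _ => ?_
    simp only [C_mul]; ring
  rw [h, ← Finset.sum_sub_distrib]
  simp only [map_mul, reflHom_C, reflHom_X, mul_sub]

lemma linForm_ne_zero {v : Fin d → ℂ} (hv : v ⬝ᵥ v = 1) : linForm v ≠ 0 := by
  intro h
  have : eval v (linForm v) = v ⬝ᵥ v := by simp [linForm, dotProduct]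
  rw [h, hv, map_zero] at this
  exact zero_ne_one this

/-- Modulo the linear form `⟨v, ·⟩`, the substitution fixes every variable, so it induces the same
homomorphism to the quotient ring as the identity. -/
lemma linForm_dvd_sub_reflHom (p : MvPolynomial (Fin d) ℂ) : linForm v ∣ p - reflHom v p := by
  rw [← Ideal.mem_span_singleton, ← Ideal.Quotient.mk_eq_mk_iff_sub_mem]
  have : (Ideal.Quotient.mkₐ ℂ (Ideal.span {linForm v})) =
      (Ideal.Quotient.mkₐ ℂ (Ideal.span {linForm v})).comp (reflHom v) := by
    ext1 i
    simp only [AlgHom.comp_apply, reflHom_X, Ideal.Quotient.mkₐ_eq_mk]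
    rw [Ideal.Quotient.mk_eq_mk_iff_sub_mem, sub_sub_cancel]
    exact Ideal.mul_mem_left _ _ (Ideal.mem_span_singleton_self _)
  exact DFunLike.congr_fun this p

/-- Cancellation in the domain of polynomials makes the quotient unique, so a choice made separately
for each `p` is automatically linear. -/
lemma exists_divDiff : ∃ D : MvPolynomial (Fin d) ℂ →ₗ[ℂ] MvPolynomial (Fin d) ℂ,
    ∀ p, linForm v * D p = p - reflHom v p := by
  choose D hD using linForm_dvd_sub_reflHom v
  by_cases h : linForm v = 0
  · refine ⟨0, fun p => ?_⟩
    rw [hD, h]; simp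
  · refine ⟨⟨⟨D, fun p q => ?_⟩, fun c p => ?_⟩, fun p => (hD p).symm⟩
    · apply mul_left_cancel₀ h
      rw [mul_add, ← hD, ← hD, ← hD, map_add]; ring
    · apply mul_left_cancel₀ h
      rw [RingHom.id_apply, mul_smul_comm, ← hD, ← hD, map_smul, smul_sub]

/-- The divided difference `p ↦ (p - p ∘ σ_v) / ⟨v, ·⟩`. -/
def divDiff : MvPolynomial (Fin d) ℂ →ₗ[ℂ] MvPolynomial (Fin d) ℂ := (exists_divDiff v).choose

lemma linForm_mul_divDiff (p : MvPolynomial (Fin d) ℂ) :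
    linForm v * divDiff v p = p - reflHom v p := (exists_divDiff v).choose_spec p

variable {v}

lemma divDiff_neg (hv : v ⬝ᵥ v = 1) (p : MvPolynomial (Fin d) ℂ) :
    divDiff (-v) p = -divDiff v p := by
  apply mul_left_cancel₀ (linForm_ne_zero hv)
  have := linForm_mul_divDiff (-v) p
  rw [linForm_neg, reflHom_neg] at this
  rw [mul_neg, linForm_mul_divDiff, ← this]; ring

lemma divDiff_C (hv : v ⬝ᵥ v = 1) (c : ℂ) : divDiff v (C c) = 0 := by
  apply mul_left_cancel₀ (linForm_ne_zero hv)
  rw [linForm_mul_divDiff]; simp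

/-- A twisted Leibniz rule; the correction comes from `x_l - σ_v x_l = 2 v_l ⟨v, x⟩`. -/
lemma divDiff_X_mul (hv : v ⬝ᵥ v = 1) (l : Fin d) (p : MvPolynomial (Fin d) ℂ) :
    divDiff v (X l * p) = X l * divDiff v p + C (2 * v l) * reflHom v p := by
  apply mul_left_cancel₀ (linForm_ne_zero hv)
  rw [linForm_mul_divDiff, mul_add, mul_left_comm, linForm_mul_divDiff, map_mul, reflHom_X]
  ring

lemma dotProduct_reflVec (v u : Fin d → ℂ) (hv : v ⬝ᵥ v = 1) : v ⬝ᵥ reflVec v u = -(v ⬝ᵥ u) := by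
  have : reflVec v u = u - (2 * (v ⬝ᵥ u)) • v := by ext i; simp [reflVec]
  rw [this, dotProduct_sub, dotProduct_smul, hv, smul_eq_mul]; ring

lemma reflVec_reflVec (u : Fin d → ℂ) (hv : v ⬝ᵥ v = 1) : reflVec v (reflVec v u) = u := by
  ext i
  rw [reflVec, dotProduct_reflVec v u hv, reflVec]; ring

/-- This is the conjugation rule for reflections: conjugating `σ_u` by `σ_v` gives the reflection in
`σ_v u`. -/
lemma reflHom_reflHom_reflVec (hv : v ⬝ᵥ v = 1) (u : Fin d → ℂ) (p : MvPolynomial (Fin d) ℂ) :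
    reflHom v (reflHom (reflVec v u) p) = reflHom u (reflHom v p) := by
  have : (reflHom v).comp (reflHom (reflVec v u)) = (reflHom u).comp (reflHom v) := by
    ext1 i
    simp only [AlgHom.comp_apply, reflHom_X, map_sub, map_mul, reflHom_C, reflHom_linForm]
    rw [reflVec_reflVec u hv]
    have : linForm (reflVec u v) = linForm v - C (2 * (u ⬝ᵥ v)) * linForm u := linForm_sub _ _ _
    rw [this, reflVec, dotProduct_comm u v]
    simp only [C_mul, C_sub]
    ring
  exact DFunLike.congr_fun this p

lemma divDiff_reflHom (hv : v ⬝ᵥ v = 1) {u : Fin d → ℂ} (hu : u ⬝ᵥ u = 1)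
    (p : MvPolynomial (Fin d) ℂ) :
    divDiff u (reflHom v p) = reflHom v (divDiff (reflVec v u) p) := by
  apply mul_left_cancel₀ (linForm_ne_zero hu)
  have h : linForm u = reflHom v (linForm (reflVec v u)) := by
    rw [reflHom_linForm, reflVec_reflVec u hv]
  rw [linForm_mul_divDiff, h, ← map_mul, linForm_mul_divDiff, map_sub,
    reflHom_reflHom_reflVec hv]

lemma pderiv_linForm (i : Fin d) : pderiv i (linForm v) = C (v i) := by
  simp [linForm, pderiv_X, Pi.single_apply]

/-- The chain rule: the gradient of `p ∘ σ_v` is the reflected gradient, evaluated at the reflected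
point. -/
lemma pderiv_reflHom (v : Fin d → ℂ) (i : Fin d) (p : MvPolynomial (Fin d) ℂ) :
    pderiv i (reflHom v p) =
      reflHom v (pderiv i p) - C (2 * v i) * ∑ l, C (v l) * reflHom v (pderiv l p) := by
  induction p using MvPolynomial.induction_on with
  | C a => simp
  | add p q hp hq =>
    simp only [map_add, hp, hq, mul_add, Finset.sum_add_distrib]; ring
  | mul_X p j hp =>
    have h (l : Fin d) : reflHom v (pderiv l (p * X j)) =
        reflHom v (pderiv l p) * reflHom v (X j) + reflHom v p * if l = j then 1 else 0 := by
      rw [pderiv_mul, pderiv_X, Pi.single_apply]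
      simp only [map_add, map_mul, @eq_comm _ j l]
      split_ifs <;> simp
    have h2 : ∑ l, C (v l) * reflHom v (pderiv l (p * X j)) =
        (∑ l, C (v l) * reflHom v (pderiv l p)) * reflHom v (X j) + C (v j) * reflHom v p := by
      simp only [h, mul_add, Finset.sum_add_distrib, Finset.sum_mul, mul_assoc]
      simp
    have h3 : pderiv i (reflHom v (X j)) =
        (if i = j then 1 else 0) - C (2 * v j) * C (v i) := by
      rw [reflHom_X, map_sub, pderiv_C_mul, pderiv_linForm, pderiv_X, Pi.single_apply]
      simp only [@eq_comm _ j i]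
    rw [h2, h, map_mul, pderiv_mul, hp, h3]
    simp only [C_mul]
    ring

lemma isHomogeneous_linForm (v : Fin d → ℂ) : (linForm v).IsHomogeneous 1 :=
  IsHomogeneous.sum _ _ _ fun _ _ => isHomogeneous_C_mul_X _ _

lemma isHomogeneous_reflHom {p : MvPolynomial (Fin d) ℂ} {m : ℕ} (hp : p.IsHomogeneous m)
    (v : Fin d → ℂ) : (reflHom v p).IsHomogeneous m := by
  have := hp.aeval (fun i => X i - C (2 * v i) * linForm v) (n := 1)
    fun i => (isHomogeneous_X _ _).sub ((isHomogeneous_linForm v).C_mul _)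
  rwa [one_mul] at this

end General

/-! ### Reindexing sums over a full period -/

section Periodic

variable {M : Type*} [AddCommMonoid M] {n : ℕ}

lemma sum_fin_eq_sum_zmod [NeZero n] {F : ℤ → M} (hF : Function.Periodic F n) (e : ZMod n ≃ ZMod n)
    (f : ℤ → ℤ) (hf : ∀ j : ℤ, ((f j : ℤ) : ZMod n) = e j) :
    ∑ j : Fin n, F (f (j : ℕ)) = ∑ j : Fin n, F (j : ℕ) := by
  have key (a b : ℤ) (h : (a : ZMod n) = b) : F a = F b := by
    obtain ⟨c, hc⟩ := (ZMod.intCast_eq_intCast_iff_dvd_sub a b n).1 h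
    have := hF.int_mul c a
    rw [← this]
    congr 1
    push_cast
    linarith
  let i : Fin n ≃ ZMod n :=
    { toFun := fun j => (j : ℕ)
      invFun := fun z => ⟨z.val, z.val_lt⟩
      left_inv := fun j => by ext; simp [ZMod.val_natCast_of_lt j.2]
      right_inv := fun z => by simp }
  have hi (j : Fin n) : i j = ((j : ℕ) : ZMod n) := rfl
  refine Fintype.sum_equiv ((i.trans e).trans i.symm) _ _ fun j => key _ _ ?_
  rw [hf]
  have : i (((i.trans e).trans i.symm) j) = e (i j) := by simp
  rw [hi, hi] at this
  rw [Int.cast_natCast, Int.cast_natCast, this]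

lemma sum_fin_sub_of_periodic (hn : n ≠ 0) {F : ℤ → M} (hF : Function.Periodic F n) (c : ℤ) :
    ∑ j : Fin n, F (c - (j : ℕ)) = ∑ j : Fin n, F (j : ℕ) := by
  have : NeZero n := ⟨hn⟩
  exact sum_fin_eq_sum_zmod hF (Equiv.subLeft (c : ZMod n)) (fun j => c - j) fun j => by simp

lemma sum_fin_add_of_periodic (hn : n ≠ 0) {F : ℤ → M} (hF : Function.Periodic F n) (c : ℤ) :
    ∑ j : Fin n, F (c + (j : ℕ)) = ∑ j : Fin n, F (j : ℕ) := by
  have : NeZero n := ⟨hn⟩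
  exact sum_fin_eq_sum_zmod hF (Equiv.addLeft (c : ZMod n)) (fun j => c + j) fun j => by simp

end Periodic

/-! ### Inverting `(m + γ) - k S` for an abstract family of dihedral reflections -/

section ReflectionSum

variable {M : Type*} [AddCommGroup M] [Module ℂ M]

/-- The sum over `0 ≤ j < n` of a family of endomorphisms indexed by `ℤ`. -/
def reflSum (n : ℕ) (ρ : ℤ → M →ₗ[ℂ] M) : M →ₗ[ℂ] M := ∑ j : Fin n, ρ (j : ℕ)

lemma reflSum_apply (n : ℕ) (ρ : ℤ → M →ₗ[ℂ] M) (x : M) :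
    reflSum n ρ x = ∑ j : Fin n, ρ (j : ℕ) x := by
  simp [reflSum]

/-- A family of endomorphisms that multiplies like the reflections of the dihedral group of
order `2 n`. -/
structure IsDihedralFamily (n : ℕ) (ρ : ℤ → M →ₗ[ℂ] M) : Prop where
  periodic : Function.Periodic ρ n
  triple : ∀ a b c x, ρ a (ρ b (ρ c x)) = ρ (a - b + c) x

variable {n : ℕ} {ρ : ℤ → M →ₗ[ℂ] M}

/-- A triple product has index `a - b + c`; for fixed `a` and `b`, letting `c` run over a period
gives the whole sum, and there are `n²` pairs. Thus `S (S - n) (S + n) = 0`. -/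
lemma IsDihedralFamily.reflSum_cube (h : IsDihedralFamily n ρ) (hn : n ≠ 0) (x : M) :
    reflSum n ρ (reflSum n ρ (reflSum n ρ x)) = ((n : ℂ) ^ 2) • reflSum n ρ x := by
  have hp : Function.Periodic (fun j => ρ j x) n := fun j => by
    simp only [h.periodic j]
  have : ∀ a b : Fin n, ∑ c : Fin n, ρ ((a : ℕ) - (b : ℕ) + (c : ℕ)) x = reflSum n ρ x :=
    fun a b => by
      rw [reflSum_apply]
      exact sum_fin_add_of_periodic hn hp _
  calc _ = ∑ a : Fin n, ∑ b : Fin n, ∑ c : Fin n, ρ ((a : ℕ) - (b : ℕ) + (c : ℕ)) x := by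
        simp_rw [← h.triple, ← map_sum, ← reflSum_apply]
    _ = _ := by
        simp only [this, Finset.sum_const, Finset.card_univ, Fintype.card_fin, smul_smul,
          ← Nat.cast_smul_eq_nsmul ℂ, sq]

/-- The inverse of `(m + n k) - k S`, where `S` is the sum of the `n` reflections. -/
def shiftInv (n : ℕ) (k : ℂ) (ρ : ℤ → M →ₗ[ℂ] M) (m : ℕ) : M →ₗ[ℂ] M :=
  (1 / (m + n * k)) • (LinearMap.id - (1 / (n : ℂ) ^ 2) • reflSum n ρ ∘ₗ reflSum n ρ) +
  (1 / (2 * m : ℂ)) • ((1 / (n : ℂ) ^ 2) • reflSum n ρ ∘ₗ reflSum n ρ +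
    (1 / (n : ℂ)) • reflSum n ρ) +
  (1 / (2 * (m + 2 * n * k))) • ((1 / (n : ℂ) ^ 2) • reflSum n ρ ∘ₗ reflSum n ρ -
    (1 / (n : ℂ)) • reflSum n ρ)

lemma shiftInv_apply (n : ℕ) (k : ℂ) (ρ : ℤ → M →ₗ[ℂ] M) (m : ℕ) (x : M) :
    shiftInv n k ρ m x =
      (1 / (m + n * k)) • (x - (1 / (n : ℂ) ^ 2) • reflSum n ρ (reflSum n ρ x)) +
      (1 / (2 * m : ℂ)) • ((1 / (n : ℂ) ^ 2) • reflSum n ρ (reflSum n ρ x) +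
        (1 / (n : ℂ)) • reflSum n ρ x) +
      (1 / (2 * (m + 2 * n * k))) • ((1 / (n : ℂ) ^ 2) • reflSum n ρ (reflSum n ρ x) -
        (1 / (n : ℂ)) • reflSum n ρ x) := rfl

variable {k : ℂ} {m : ℕ}

/-- The two eigenvalues are excluded by the hypothesis at `2 m` and at `m` respectively. -/
lemma nonsingular (hk : ∀ m : ℕ, 1 ≤ m → (n : ℂ) * k ≠ -((m : ℂ) / 2)) (hm : 1 ≤ m) :
    (m : ℂ) + n * k ≠ 0 ∧ (m : ℂ) + 2 * n * k ≠ 0 := by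
  constructor
  · intro h
    apply hk (2 * m) (by omega)
    push_cast
    linear_combination h
  · intro h
    apply hk m hm
    linear_combination h / 2

/-- The summands of `shiftInv` are the spectral projections `1 - S²/n²` and `(S²/n² ± S/n)/2` of
`S`, for `0` and `±n`, each divided by the eigenvalue of `(m + n k) - k S` there. -/
lemma shiftInv_shift (h : IsDihedralFamily n ρ) (hn : n ≠ 0)
    (hk : ∀ m : ℕ, 1 ≤ m → (n : ℂ) * k ≠ -((m : ℂ) / 2)) (hm : 1 ≤ m) (x : M) :
    shiftInv n k ρ m (((m : ℂ) + n * k) • x - k • reflSum n ρ x) = x := by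
  obtain ⟨h1, h2⟩ := nonsingular hk hm
  have h3 : (m : ℂ) ≠ 0 := by exact_mod_cast (by omega : m ≠ 0)
  have h4 : (n : ℂ) ≠ 0 := by exact_mod_cast hn
  simp only [shiftInv_apply, map_sub, map_smul, h.reflSum_cube hn]
  generalize reflSum n ρ (reflSum n ρ x) = z
  generalize reflSum n ρ x = y
  -- The denominators stay atomic while they are cleared; their values are restored only for the
  -- final polynomial identity.
  generalize ha : (m : ℂ) + n * k = a at *
  generalize hb : (m : ℂ) + 2 * n * k = b at *
  match_scalars <;> field_simp <;> rw [← ha, ← hb] <;> ring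

lemma shift_shiftInv (h : IsDihedralFamily n ρ) (hn : n ≠ 0)
    (hk : ∀ m : ℕ, 1 ≤ m → (n : ℂ) * k ≠ -((m : ℂ) / 2)) (hm : 1 ≤ m) (x : M) :
    ((m : ℂ) + n * k) • shiftInv n k ρ m x - k • reflSum n ρ (shiftInv n k ρ m x) = x := by
  obtain ⟨h1, h2⟩ := nonsingular hk hm
  have h3 : (m : ℂ) ≠ 0 := by exact_mod_cast (by omega : m ≠ 0)
  have h4 : (n : ℂ) ≠ 0 := by exact_mod_cast hn
  simp only [shiftInv_apply, map_sub, map_add, map_smul, h.reflSum_cube hn]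
  generalize reflSum n ρ (reflSum n ρ x) = z
  generalize reflSum n ρ x = y
  generalize ha : (m : ℂ) + n * k = a at *
  generalize hb : (m : ℂ) + 2 * n * k = b at *
  match_scalars <;> field_simp <;> rw [← ha, ← hb] <;> ring

lemma shift_injective (h : IsDihedralFamily n ρ) (hn : n ≠ 0)
    (hk : ∀ m : ℕ, 1 ≤ m → (n : ℂ) * k ≠ -((m : ℂ) / 2)) (hm : 1 ≤ m) {x y : M}
    (hxy : ((m : ℂ) + n * k) • x - k • reflSum n ρ x =
      ((m : ℂ) + n * k) • y - k • reflSum n ρ y) : x = y := by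
  rw [← shiftInv_shift h hn hk hm x, hxy, shiftInv_shift h hn hk hm y]

end ReflectionSum

/-! ### The dihedral roots and their reflections on polynomials and vector fields -/

/-- The action of the reflection in the unit vector `v` on vector fields with polynomial
coefficients. -/
def reflAct {d : ℕ} (v : Fin d → ℂ) :
    (Fin d → MvPolynomial (Fin d) ℂ) →ₗ[ℂ] (Fin d → MvPolynomial (Fin d) ℂ) :=
  LinearMap.pi fun i => (reflHom v).toLinearMap ∘ₗ LinearMap.proj i -
    (2 * v i) • ∑ l, v l • (reflHom v).toLinearMap ∘ₗ LinearMap.proj l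

lemma reflAct_apply {d : ℕ} (v : Fin d → ℂ) (g : Fin d → MvPolynomial (Fin d) ℂ) (i : Fin d) :
    reflAct v g i = reflHom v (g i) - C (2 * v i) * ∑ l, C (v l) * reflHom v (g l) := by
  simp [reflAct, smul_eq_C_mul]

/-- The angle `π j / n`. -/
def rootAngle (n : ℕ) (j : ℤ) : ℝ := Real.pi * j / n

/-- The root `i w ^ j`, `w = exp (i π / n)`, with `j` ranging over all integers. -/
def rootVec (n : ℕ) (j : ℤ) : Fin 2 → ℂ :=
  ![((-Real.sin (rootAngle n j) : ℝ) : ℂ), ((Real.cos (rootAngle n j) : ℝ) : ℂ)]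

lemma rootVec_zero (n : ℕ) (j : ℤ) :
    rootVec n j 0 = ((-Real.sin (rootAngle n j) : ℝ) : ℂ) := rfl

lemma rootVec_one (n : ℕ) (j : ℤ) :
    rootVec n j 1 = ((Real.cos (rootAngle n j) : ℝ) : ℂ) := rfl

lemma rootVec_dotProduct_self (n : ℕ) (j : ℤ) : rootVec n j ⬝ᵥ rootVec n j = 1 := by
  simp only [dotProduct, Fin.sum_univ_two, rootVec_zero, rootVec_one]
  norm_cast
  linarith [Real.sin_sq_add_cos_sq (rootAngle n j)]

lemma rootAngle_add (n : ℕ) (a b : ℤ) :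
    rootAngle n (a + b) = rootAngle n a + rootAngle n b := by
  simp only [rootAngle]; push_cast; ring

lemma rootAngle_sub (n : ℕ) (a b : ℤ) :
    rootAngle n (a - b) = rootAngle n a - rootAngle n b := by
  simp only [rootAngle]; push_cast; ring

lemma rootAngle_self {n : ℕ} (hn : n ≠ 0) : rootAngle n n = Real.pi := by
  have : (n : ℝ) ≠ 0 := by exact_mod_cast hn
  simp only [rootAngle]; push_cast; field_simp

/-- The roots are periodic only up to sign, so reindexing modulo `n` is limited to expressions even
in the root. -/
lemma rootVec_add_self {n : ℕ} (hn : n ≠ 0) (j : ℤ) : rootVec n (j + n) = -rootVec n j := by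
  ext i
  fin_cases i <;> simp [rootVec, rootAngle_add, rootAngle_self hn]

lemma reflVec_rootVec (n : ℕ) (h j : ℤ) :
    reflVec (rootVec n h) (rootVec n j) = -rootVec n (2 * h - j) := by
  have e : rootAngle n (2 * h - j) = rootAngle n h + rootAngle n h - rootAngle n j := by
    rw [two_mul, rootAngle_sub, rootAngle_add]
  have hs := Real.sin_sq_add_cos_sq (rootAngle n h)
  have hd : rootVec n h ⬝ᵥ rootVec n j =
      ((Real.sin (rootAngle n h) * Real.sin (rootAngle n j) +
        Real.cos (rootAngle n h) * Real.cos (rootAngle n j) : ℝ) : ℂ) := by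
    simp only [dotProduct, Fin.sum_univ_two, rootVec_zero, rootVec_one]
    push_cast; ring
  ext i
  fin_cases i
  · simp only [reflVec, hd, Fin.zero_eta, rootVec_zero, Pi.neg_apply, e, Real.sin_sub,
      Real.sin_add, Real.cos_add]
    norm_cast
    linear_combination Real.sin (rootAngle n j) * hs
  · simp only [reflVec, hd, Fin.mk_one, rootVec_one, Pi.neg_apply, e, Real.cos_sub,
      Real.sin_add, Real.cos_add]
    norm_cast
    linear_combination -Real.cos (rootAngle n j) * hs

/-- `cos (2 π j / n)` as a constant polynomial. -/
def cosC (n : ℕ) (j : ℤ) : MvPolynomial (Fin 2) ℂ := C ((Real.cos (2 * rootAngle n j) : ℝ) : ℂ)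

/-- `sin (2 π j / n)` as a constant polynomial. -/
def sinC (n : ℕ) (j : ℤ) : MvPolynomial (Fin 2) ℂ := C ((Real.sin (2 * rootAngle n j) : ℝ) : ℂ)

lemma cosC_triple (n : ℕ) (a b c : ℤ) : cosC n (a - b + c) =
    (cosC n a * cosC n b + sinC n a * sinC n b) * cosC n c -
      (sinC n a * cosC n b - cosC n a * sinC n b) * sinC n c := by
  simp only [cosC, sinC, rootAngle_add, rootAngle_sub, mul_add, mul_sub, Real.cos_add,
    Real.cos_sub, Real.sin_sub]
  simp only [Complex.ofReal_add, Complex.ofReal_sub, Complex.ofReal_mul, C_add, C_sub, C_mul]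

lemma sinC_triple (n : ℕ) (a b c : ℤ) : sinC n (a - b + c) =
    (sinC n a * cosC n b - cosC n a * sinC n b) * cosC n c +
      (cosC n a * cosC n b + sinC n a * sinC n b) * sinC n c := by
  simp only [cosC, sinC, rootAngle_add, rootAngle_sub, mul_add, mul_sub, Real.sin_add,
    Real.cos_sub, Real.sin_sub]
  simp only [Complex.ofReal_add, Complex.ofReal_sub, Complex.ofReal_mul, C_add, C_sub, C_mul]

lemma cosC_eq_one_sub (n : ℕ) (j : ℤ) :
    cosC n j = 1 - C (2 * rootVec n j 0) * C (rootVec n j 0) := by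
  rw [cosC, ← C_mul, ← C_1, ← C_sub, rootVec_zero]
  congr 1
  norm_cast
  rw [Real.cos_two_mul]
  linarith [Real.sin_sq_add_cos_sq (rootAngle n j)]

lemma cosC_eq_sub_one (n : ℕ) (j : ℤ) :
    cosC n j = C (2 * rootVec n j 1) * C (rootVec n j 1) - 1 := by
  rw [cosC, ← C_mul, ← C_1, ← C_sub, rootVec_one]
  congr 1
  norm_cast
  rw [Real.cos_two_mul]
  ring

lemma sinC_eq_neg (n : ℕ) (j : ℤ) :
    sinC n j = -(C (2 * rootVec n j 0) * C (rootVec n j 1)) := by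
  rw [sinC, ← C_mul, ← C_neg, rootVec_zero, rootVec_one]
  congr 1
  norm_cast
  rw [Real.sin_two_mul]
  ring

lemma reflAct_rootVec_zero (n : ℕ) (j : ℤ) (g : Fin 2 → MvPolynomial (Fin 2) ℂ) :
    reflAct (rootVec n j) g 0 = cosC n j * reflHom (rootVec n j) (g 0) +
      sinC n j * reflHom (rootVec n j) (g 1) := by
  rw [reflAct_apply, Fin.sum_univ_two, cosC_eq_one_sub, sinC_eq_neg]
  ring

lemma reflAct_rootVec_one (n : ℕ) (j : ℤ) (g : Fin 2 → MvPolynomial (Fin 2) ℂ) :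
    reflAct (rootVec n j) g 1 = sinC n j * reflHom (rootVec n j) (g 0) -
      cosC n j * reflHom (rootVec n j) (g 1) := by
  rw [reflAct_apply, Fin.sum_univ_two, cosC_eq_sub_one, sinC_eq_neg]
  simp only [C_mul]
  ring

lemma reflHom_rootVec_X_zero (n : ℕ) (j : ℤ) :
    reflHom (rootVec n j) (X 0) = cosC n j * X 0 + sinC n j * X 1 := by
  rw [reflHom_X, linForm, Fin.sum_univ_two, cosC_eq_one_sub, sinC_eq_neg]
  ring

lemma reflHom_rootVec_X_one (n : ℕ) (j : ℤ) :
    reflHom (rootVec n j) (X 1) = sinC n j * X 0 - cosC n j * X 1 := by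
  rw [reflHom_X, linForm, Fin.sum_univ_two, cosC_eq_sub_one, sinC_eq_neg]
  simp only [C_mul]
  ring

@[simp] lemma reflHom_cosC {n : ℕ} (v : Fin 2 → ℂ) (j : ℤ) :
    reflHom v (cosC n j) = cosC n j := reflHom_C _ _

@[simp] lemma reflHom_sinC {n : ℕ} (v : Fin 2 → ℂ) (j : ℤ) :
    reflHom v (sinC n j) = sinC n j := reflHom_C _ _

/-- Composition of substitutions reverses the order of the reflections, but this is harmless because
the index `a - b + c` is symmetric in `a` and `c`. -/
lemma reflHom_rootVec_triple (n : ℕ) (a b c : ℤ) (p : MvPolynomial (Fin 2) ℂ) :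
    reflHom (rootVec n a) (reflHom (rootVec n b) (reflHom (rootVec n c) p)) =
      reflHom (rootVec n (a - b + c)) p := by
  have : (reflHom (rootVec n a)).comp ((reflHom (rootVec n b)).comp (reflHom (rootVec n c))) =
      reflHom (rootVec n (a - b + c)) := by
    ext1 i
    fin_cases i
    all_goals
      simp only [AlgHom.comp_apply, Fin.zero_eta, Fin.mk_one, reflHom_rootVec_X_zero,
        reflHom_rootVec_X_one, map_add, map_sub, map_mul, reflHom_cosC, reflHom_sinC,
        cosC_triple, sinC_triple]
      ring
  exact DFunLike.congr_fun this p

lemma isDihedralFamily_reflHom {n : ℕ} (hn : n ≠ 0) :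
    IsDihedralFamily n (fun j => (reflHom (rootVec n j)).toLinearMap) where
  periodic j := by
    simp only [rootVec_add_self hn, reflHom_neg]
  triple a b c p := reflHom_rootVec_triple n a b c p

lemma isDihedralFamily_reflAct {n : ℕ} (hn : n ≠ 0) :
    IsDihedralFamily n (fun j => reflAct (rootVec n j)) where
  periodic j := by
    refine LinearMap.ext fun g => funext fun i => ?_
    simp only [rootVec_add_self hn, reflAct_apply, reflHom_neg, Pi.neg_apply, mul_neg, C_neg,
      neg_mul, Finset.sum_neg_distrib, neg_neg]
  triple a b c g := by
    ext1 i
    fin_cases i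
    all_goals
      simp only [Fin.zero_eta, Fin.mk_one, reflAct_rootVec_zero, reflAct_rootVec_one, map_add,
        map_sub, map_mul, reflHom_cosC, reflHom_sinC, reflHom_rootVec_triple,
        cosC_triple, sinC_triple]
      ring

/-- The operator `p ↦ ∑ p ∘ σ_α`, the sum being over the positive roots `α`. -/
def polyReflSum (n : ℕ) : MvPolynomial (Fin 2) ℂ →ₗ[ℂ] MvPolynomial (Fin 2) ℂ :=
  reflSum n (fun j => (reflHom (rootVec n j)).toLinearMap)

lemma polyReflSum_apply (n : ℕ) (p : MvPolynomial (Fin 2) ℂ) :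
    polyReflSum n p = ∑ j : Fin n, reflHom (rootVec n (j : ℕ)) p := reflSum_apply _ _ _

/-! ### Dunkl operators on polynomials: Euler identity and equivariance -/

/-- The partial Dunkl operator `T_{e_i}` on polynomials. -/
def dunklPoly (n : ℕ) (k : ℂ) (i : Fin 2) : MvPolynomial (Fin 2) ℂ →ₗ[ℂ] MvPolynomial (Fin 2) ℂ :=
  (pderiv i).toLinearMap + k • ∑ j : Fin n, rootVec n (j : ℕ) i • divDiff (rootVec n (j : ℕ))

lemma dunklPoly_apply (n : ℕ) (k : ℂ) (i : Fin 2) (p : MvPolynomial (Fin 2) ℂ) :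
    dunklPoly n k i p = pderiv i p +
      C k * ∑ j : Fin n, C (rootVec n (j : ℕ) i) * divDiff (rootVec n (j : ℕ)) p := by
  simp [dunklPoly, smul_eq_C_mul]

variable {n : ℕ} {k : ℂ}

lemma dunklPoly_C (i : Fin 2) (c : ℂ) : dunklPoly n k i (C c) = 0 := by
  simp [dunklPoly_apply, divDiff_C (rootVec_dotProduct_self n _)]

lemma dunklPoly_X_mul (i l : Fin 2) (p : MvPolynomial (Fin 2) ℂ) :
    dunklPoly n k i (X l * p) = X l * dunklPoly n k i p + (if l = i then p else 0) +
      C k * ∑ j : Fin n, C (rootVec n (j : ℕ) i) * (C (2 * rootVec n (j : ℕ) l) *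
        reflHom (rootVec n (j : ℕ)) p) := by
  simp only [dunklPoly_apply, divDiff_X_mul (rootVec_dotProduct_self n _), pderiv_mul, pderiv_X,
    mul_add, Finset.sum_add_distrib, Pi.single_apply]
  have : ∑ j : Fin n, C (rootVec n (j : ℕ) i) * (X l * divDiff (rootVec n (j : ℕ)) p) =
      X l * ∑ j : Fin n, C (rootVec n (j : ℕ) i) * divDiff (rootVec n (j : ℕ)) p := by
    rw [Finset.mul_sum]
    exact Finset.sum_congr rfl fun j _ => by ring
  rw [this]
  split_ifs <;> ring

/-- The derivative part contributes `m p` by Euler's identity. Each root contributes `k (p - p ∘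
σ_α)`, since `∑ x_i α_i` is the denominator of the divided difference. -/
lemma sum_X_mul_dunklPoly (m : ℕ) (p : MvPolynomial (Fin 2) ℂ) (hp : p.IsHomogeneous m) :
    ∑ i, X i * dunklPoly n k i p = ((m : ℂ) + n * k) • p - k • polyReflSum n p := by
  have h : ∑ i, X i * (C k * ∑ j : Fin n, C (rootVec n (j : ℕ) i) *
      divDiff (rootVec n (j : ℕ)) p) = C k * ((n : MvPolynomial (Fin 2) ℂ) * p -
        polyReflSum n p) := by
    have h1 (j : Fin n) : X 0 * (C (rootVec n (j : ℕ) 0) * divDiff (rootVec n (j : ℕ)) p) +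
        X 1 * (C (rootVec n (j : ℕ) 1) * divDiff (rootVec n (j : ℕ)) p) =
          p - reflHom (rootVec n (j : ℕ)) p := by
      rw [← linForm_mul_divDiff, linForm, Fin.sum_univ_two]; ring
    rw [Fin.sum_univ_two, mul_left_comm, mul_left_comm (X 1), ← mul_add, Finset.mul_sum,
      Finset.mul_sum, ← Finset.sum_add_distrib]
    simp only [h1, Finset.sum_sub_distrib, polyReflSum_apply]
    simp
  have he := hp.sum_X_mul_pderiv
  simp only [dunklPoly_apply, mul_add, Finset.sum_add_distrib] at he ⊢
  rw [he, h]
  simp only [smul_eq_C_mul, C_add, C_mul, nsmul_eq_mul]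
  simp only [map_natCast]
  ring

/-- Equivariance of the Dunkl gradient. Conjugation by the reflection `h` sends the root `j` to
minus the root `2 h - j`; the summand `Φ` is even in the root, hence `n`-periodic, so the sum is
unchanged. -/
lemma dunklPoly_reflHom (hn : n ≠ 0) (h : ℤ) (i : Fin 2) (p : MvPolynomial (Fin 2) ℂ) :
    dunklPoly n k i (reflHom (rootVec n h) p) =
      reflAct (rootVec n h) (fun l => dunklPoly n k l p) i := by
  have hu := rootVec_dotProduct_self n
  set Φ : ℤ → MvPolynomial (Fin 2) ℂ := fun j =>
    C (reflVec (rootVec n h) (rootVec n j) i) *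
      reflHom (rootVec n h) (divDiff (rootVec n j) p) with hΦ
  have hper : Function.Periodic Φ n := fun j => by
    have : reflVec (rootVec n h) (-rootVec n j) = -reflVec (rootVec n h) (rootVec n j) := by
      ext i; simp [reflVec]; ring
    simp only [hΦ, rootVec_add_self hn, divDiff_neg (hu j), this, Pi.neg_apply, map_neg]
    ring
  have h1 (j : ℤ) : C (rootVec n j i) * divDiff (rootVec n j) (reflHom (rootVec n h) p) =
      Φ (2 * h - j) := by
    rw [divDiff_reflHom (hu h) (hu j), reflVec_rootVec, divDiff_neg (hu _), map_neg]
    simp only [hΦ, reflVec_rootVec, Pi.neg_apply, C_neg, sub_sub_cancel]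
    ring
  have h2 (j : ℤ) : Φ j = reflAct (rootVec n h)
      (fun l => C (rootVec n j l) * divDiff (rootVec n j) p) i := by
    simp only [hΦ, reflAct_apply, map_mul, reflHom_C, reflVec, dotProduct, C_sub, Fin.sum_univ_two,
      C_add]
    ring
  have h3 : (fun l => dunklPoly n k l p) = (fun l => pderiv l p) +
      k • ∑ j : Fin n, fun l => C (rootVec n (j : ℕ) l) * divDiff (rootVec n (j : ℕ)) p := by
    ext1 l
    simp [dunklPoly_apply, smul_eq_C_mul]
  rw [h3, map_add, map_smul, map_sum, dunklPoly_apply]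
  simp only [h1, Pi.add_apply, Pi.smul_apply, Finset.sum_apply, ← h2]
  rw [sum_fin_sub_of_periodic hn hper, smul_eq_C_mul, pderiv_reflHom, reflAct_apply]

/-! ### Construction of the intertwining operator -/

section Construction

variable {n : ℕ} {k : ℂ}

lemma isHomogeneous_polyReflSum {p : MvPolynomial (Fin 2) ℂ} {m : ℕ} (hp : p.IsHomogeneous m)
    (n : ℕ) : (polyReflSum n p).IsHomogeneous m := by
  rw [polyReflSum_apply]
  exact IsHomogeneous.sum _ _ _ fun _ _ => isHomogeneous_reflHom hp _

lemma isHomogeneous_smul {p : MvPolynomial (Fin 2) ℂ} {m : ℕ} (hp : p.IsHomogeneous m) (c : ℂ) :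
    (c • p).IsHomogeneous m := by
  rw [smul_eq_C_mul]; exact hp.C_mul c

lemma isHomogeneous_shiftInv {p : MvPolynomial (Fin 2) ℂ} {m : ℕ} (hp : p.IsHomogeneous m)
    (n : ℕ) (k : ℂ) (l : ℕ) : (shiftInv n k (fun j => (reflHom (rootVec n j)).toLinearMap) l
      p).IsHomogeneous m := by
  have h1 := isHomogeneous_polyReflSum hp n
  have h2 := isHomogeneous_polyReflSum h1 n
  rw [shiftInv_apply]
  exact (isHomogeneous_smul (hp.sub (isHomogeneous_smul h2 _)) _).add
    (isHomogeneous_smul ((isHomogeneous_smul h2 _).add (isHomogeneous_smul h1 _)) _) |>.add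
    (isHomogeneous_smul ((isHomogeneous_smul h2 _).sub (isHomogeneous_smul h1 _)) _)

/-- If the compatibility condition `T_i q_l = T_l q_i` holds, then the solution of the Euler
equation with right hand side `∑ X_l q_l` solves `T_i f = q_i`. -/
lemma dunklPoly_eq_of_euler (hn : n ≠ 0)
    (hk : ∀ m : ℕ, 1 ≤ m → (n : ℂ) * k ≠ -((m : ℂ) / 2)) {m : ℕ}
    {q : Fin 2 → MvPolynomial (Fin 2) ℂ} (hq : ∀ i, (q i).IsHomogeneous m)
    (hc : ∀ i l, dunklPoly n k i (q l) = dunklPoly n k l (q i)) {f : MvPolynomial (Fin 2) ℂ}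
    (hf : (((m + 1 : ℕ) : ℂ) + n * k) • f - k • polyReflSum n f = ∑ l, X l * q l) (i : Fin 2) :
    dunklPoly n k i f = q i := by
  suffices h : (fun l => dunklPoly n k l f) = q from congrFun h i
  -- It suffices to compare the two vector fields after applying `(m + 1 + n k) - k S`, with `S` now
  -- the sum of the reflections acting on vector fields.
  refine shift_injective (isDihedralFamily_reflAct hn) hn hk (Nat.le_add_left 1 m) ?_
  ext1 i
  have hl : dunklPoly n k i (polyReflSum n f) =
      reflSum n (fun j => reflAct (rootVec n j)) (fun l => dunklPoly n k l f) i := by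
    simp [polyReflSum_apply, reflSum_apply, dunklPoly_reflHom hn]
  -- Compatibility turns `∑ x_l T_i q_l` into `∑ x_l T_l q_i`, to which the Euler identity in degree
  -- `m` applies. The extra `q_i` raises `m` to `m + 1`, and the `reflHom` terms cancel the
  -- reflection sum in that identity, leaving the one for vector fields.
  have hr : dunklPoly n k i (∑ l, X l * q l) = ∑ l, X l * dunklPoly n k l (q i) + q i +
      C k * ∑ j : Fin n, (reflHom (rootVec n (j : ℕ)) (q i) - reflAct (rootVec n (j : ℕ)) q i) := by
    have h (j : Fin n) : reflHom (rootVec n (j : ℕ)) (q i) - reflAct (rootVec n (j : ℕ)) q i =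
        ∑ l, C (rootVec n (j : ℕ) i) * (C (2 * rootVec n (j : ℕ) l) *
        reflHom (rootVec n (j : ℕ)) (q l)) := by
      rw [reflAct_apply, sub_sub_cancel, Finset.mul_sum]
      refine Finset.sum_congr rfl fun l _ => ?_
      simp only [C_mul]; ring
    simp only [h]
    rw [Finset.sum_comm, map_sum, Finset.mul_sum]
    simp only [dunklPoly_X_mul, Finset.sum_add_distrib, hc i]
    simp
  rw [sum_X_mul_dunklPoly m _ (hq i), ← hf, map_sub, map_smul, map_smul, hl,
    Finset.sum_sub_distrib, ← polyReflSum_apply] at hr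
  simp only [Pi.sub_apply, Pi.smul_apply]
  rw [hr, reflSum_apply]
  simp only [Finset.sum_apply, smul_eq_C_mul, C_add, C_mul, Nat.cast_add, Nat.cast_one, C_1]
  ring

/-- The restriction to homogeneous polynomials of degree `m` of the intertwining operator, as
an operator defined on all polynomials. -/
def intertwinerComp (n : ℕ) (k : ℂ) : ℕ → MvPolynomial (Fin 2) ℂ →ₗ[ℂ] MvPolynomial (Fin 2) ℂ
  | 0 => LinearMap.id
  | m + 1 => shiftInv n k (fun j => (reflHom (rootVec n j)).toLinearMap) (m + 1) ∘ₗ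
      ∑ i, LinearMap.mulLeft ℂ (X i) ∘ₗ intertwinerComp n k m ∘ₗ (pderiv i).toLinearMap

lemma intertwinerComp_succ (m : ℕ) (p : MvPolynomial (Fin 2) ℂ) :
    intertwinerComp n k (m + 1) p = shiftInv n k (fun j => (reflHom (rootVec n j)).toLinearMap)
      (m + 1) (∑ i, X i * intertwinerComp n k m (pderiv i p)) := by
  simp [intertwinerComp]

lemma isHomogeneous_intertwinerComp (m : ℕ) {p : MvPolynomial (Fin 2) ℂ}
    (hp : p.IsHomogeneous m) : (intertwinerComp n k m p).IsHomogeneous m := by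
  induction m generalizing p with
  | zero => exact hp
  | succ m ih =>
    rw [intertwinerComp_succ]
    refine isHomogeneous_shiftInv (IsHomogeneous.sum _ _ _ fun i _ => ?_) _ _ _
    rw [add_comm]
    exact (isHomogeneous_X _ _).mul (ih hp.pderiv)

lemma pderiv_comm (i l : Fin 2) (p : MvPolynomial (Fin 2) ℂ) :
    pderiv i (pderiv l p) = pderiv l (pderiv i p) := by
  ext s
  simp only [coeff_pderiv]
  rcases eq_or_ne i l with rfl | h
  · rfl
  · simp [Finsupp.add_apply, h, h.symm, add_right_comm]
    ring

/-- Commutativity of the Dunkl operators is not needed: compatibility of the fields `V(∂_i p)` comes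
from the induction hypothesis and the symmetry of second derivatives. In the base case the fields
are constant, so every `T_i` kills them. -/
lemma dunklPoly_intertwinerComp (hn : n ≠ 0)
    (hk : ∀ m : ℕ, 1 ≤ m → (n : ℂ) * k ≠ -((m : ℂ) / 2)) (m : ℕ) {p : MvPolynomial (Fin 2) ℂ}
    (hp : p.IsHomogeneous (m + 1)) (i : Fin 2) :
    dunklPoly n k i (intertwinerComp n k (m + 1) p) = intertwinerComp n k m (pderiv i p) := by
  induction m generalizing p i with
  | zero =>
    refine dunklPoly_eq_of_euler hn hk (q := fun i => intertwinerComp n k 0 (pderiv i p))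
      (fun i => isHomogeneous_intertwinerComp 0 hp.pderiv) (fun i l => ?_) ?_ i
    · have hz (i l : Fin 2) : dunklPoly n k i (intertwinerComp n k 0 (pderiv l p)) = 0 := by
        have h : (pderiv l p).IsHomogeneous 0 := hp.pderiv
        rw [← totalDegree_zero_iff_isHomogeneous, totalDegree_eq_zero_iff_eq_C] at h
        rw [intertwinerComp, LinearMap.id_apply, h, dunklPoly_C]
      rw [hz, hz]
    · rw [intertwinerComp_succ]
      exact shift_shiftInv (isDihedralFamily_reflHom hn) hn hk (Nat.le_add_left 1 0) _
  | succ m ih =>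
    refine dunklPoly_eq_of_euler hn hk (q := fun i => intertwinerComp n k (m + 1) (pderiv i p))
      (fun i => isHomogeneous_intertwinerComp _ hp.pderiv) (fun i l => ?_) ?_ i
    · rw [ih hp.pderiv, ih hp.pderiv, pderiv_comm]
    · rw [intertwinerComp_succ]
      exact shift_shiftInv (isDihedralFamily_reflHom hn) hn hk (Nat.le_add_left 1 _) _

/-- If `V p = 0` then `V(∂_i p) = T_i V p = 0`, so by induction all partial derivatives vanish, and
Euler's identity gives `p = 0`. -/
lemma intertwinerComp_injective (hn : n ≠ 0)
    (hk : ∀ m : ℕ, 1 ≤ m → (n : ℂ) * k ≠ -((m : ℂ) / 2)) (m : ℕ) {p : MvPolynomial (Fin 2) ℂ}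
    (hp : p.IsHomogeneous m) (h : intertwinerComp n k m p = 0) : p = 0 := by
  induction m generalizing p with
  | zero => exact h
  | succ m ih =>
    have h1 (i) : pderiv i p = 0 := by
      apply ih hp.pderiv
      rw [← dunklPoly_intertwinerComp hn hk m hp, h, map_zero]
    have := hp.sum_X_mul_pderiv
    simp only [h1, mul_zero, Finset.sum_const_zero] at this
    exact (smul_eq_zero.1 this.symm).resolve_left (Nat.succ_ne_zero m)

/-- The intertwining operator as a linear map. -/
def intertwiner (n : ℕ) (k : ℂ) : MvPolynomial (Fin 2) ℂ →ₗ[ℂ] MvPolynomial (Fin 2) ℂ :=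
  (basisMonomials (Fin 2) ℂ).constr ℂ fun s => intertwinerComp n k s.degree (monomial s 1)

lemma intertwiner_of_isHomogeneous {m : ℕ} {p : MvPolynomial (Fin 2) ℂ}
    (hp : p.IsHomogeneous m) : intertwiner n k p = intertwinerComp n k m p := by
  rw [p.as_sum, map_sum, map_sum]
  refine Finset.sum_congr rfl fun s hs => ?_
  have hm : s.degree = m := by
    by_contra h
    exact (mem_support_iff.1 hs) (hp.coeff_eq_zero h)
  have : monomial s (coeff s p) = coeff s p • monomial s (1 : ℂ) := by simp [smul_monomial]
  rw [this, map_smul, map_smul]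
  congr 1
  have h2 := (basisMonomials (Fin 2) ℂ).constr_basis ℂ
    (fun s => intertwinerComp n k s.degree (monomial s 1)) s
  rw [coe_basisMonomials] at h2
  rw [intertwiner, h2, hm]

lemma isHomogeneous_intertwiner {m : ℕ} {p : MvPolynomial (Fin 2) ℂ}
    (hp : p.IsHomogeneous m) : (intertwiner n k p).IsHomogeneous m := by
  rw [intertwiner_of_isHomogeneous hp]
  exact isHomogeneous_intertwinerComp m hp

lemma linearMap_ext_homogeneous {M : Type*} [AddCommMonoid M] [Module ℂ M]
    {f g : MvPolynomial (Fin 2) ℂ →ₗ[ℂ] M}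
    (h : ∀ m (p : MvPolynomial (Fin 2) ℂ), p.IsHomogeneous m → f p = g p) : f = g := by
  refine LinearMap.ext fun p => ?_
  rw [← sum_homogeneousComponent p, map_sum, map_sum]
  exact Finset.sum_congr rfl fun m _ => h m _ (homogeneousComponent_isHomogeneous m p)

lemma dunklPoly_intertwiner (hn : n ≠ 0)
    (hk : ∀ m : ℕ, 1 ≤ m → (n : ℂ) * k ≠ -((m : ℂ) / 2)) (i : Fin 2)
    (p : MvPolynomial (Fin 2) ℂ) :
    dunklPoly n k i (intertwiner n k p) = intertwiner n k (pderiv i p) := by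
  have : dunklPoly n k i ∘ₗ intertwiner n k = intertwiner n k ∘ₗ (pderiv i).toLinearMap := by
    refine linearMap_ext_homogeneous fun m p hp => ?_
    simp only [LinearMap.comp_apply, Derivation.coeFn_coe]
    cases m with
    | zero =>
      rw [intertwiner_of_isHomogeneous hp, intertwinerComp, LinearMap.id_apply]
      rw [← totalDegree_zero_iff_isHomogeneous, totalDegree_eq_zero_iff_eq_C] at hp
      rw [hp, dunklPoly_C, pderiv_C, map_zero]
    | succ m =>
      rw [intertwiner_of_isHomogeneous hp, dunklPoly_intertwinerComp hn hk m hp,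
        intertwiner_of_isHomogeneous (m := m) hp.pderiv]
  exact DFunLike.congr_fun this p

lemma homogeneousComponent_intertwiner (m : ℕ) (p : MvPolynomial (Fin 2) ℂ) :
    homogeneousComponent m (intertwiner n k p) = intertwiner n k (homogeneousComponent m p) := by
  have : homogeneousComponent m ∘ₗ intertwiner n k =
      intertwiner n k ∘ₗ homogeneousComponent m := by
    refine linearMap_ext_homogeneous fun l p hp => ?_
    simp only [LinearMap.comp_apply, homogeneousComponent_of_mem hp,
      homogeneousComponent_of_mem (isHomogeneous_intertwiner (n := n) (k := k) hp)]
    split_ifs <;> simp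
  exact DFunLike.congr_fun this p

lemma intertwiner_injective (hn : n ≠ 0)
    (hk : ∀ m : ℕ, 1 ≤ m → (n : ℂ) * k ≠ -((m : ℂ) / 2)) :
    Function.Injective (intertwiner n k) := by
  rw [injective_iff_map_eq_zero]
  intro p hp
  rw [← sum_homogeneousComponent p]
  refine Finset.sum_eq_zero fun m _ => ?_
  have h := homogeneousComponent_isHomogeneous m p
  apply intertwinerComp_injective hn hk m h
  rw [← intertwiner_of_isHomogeneous h, ← homogeneousComponent_intertwiner, hp, map_zero]

/-- Each homogeneous degree is finite-dimensional and preserved, so injectivity there gives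
surjectivity. -/
lemma intertwiner_surjective (hn : n ≠ 0)
    (hk : ∀ m : ℕ, 1 ≤ m → (n : ℂ) * k ≠ -((m : ℂ) / 2)) :
    Function.Surjective (intertwiner n k) := by
  rw [← LinearMap.range_eq_top, eq_top_iff]
  rintro p -
  rw [← sum_homogeneousComponent p]
  refine Submodule.sum_mem _ fun m _ => ?_
  have : Module.Finite ℂ (homogeneousSubmodule (Fin 2) ℂ m) :=
    Module.Finite.iff_fg.2 (homogeneousSubmodule_fg _ _ m)
  let W : homogeneousSubmodule (Fin 2) ℂ m →ₗ[ℂ] homogeneousSubmodule (Fin 2) ℂ m :=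
    (intertwiner n k).restrict fun p hp => isHomogeneous_intertwiner hp
  have hW : Function.Injective W := fun x y hxy =>
    Subtype.ext (intertwiner_injective hn hk (congrArg Subtype.val hxy))
  obtain ⟨y, hy⟩ := LinearMap.injective_iff_surjective.1 hW
    ⟨_, homogeneousComponent_isHomogeneous m p⟩
  exact ⟨y, congrArg Subtype.val hy⟩

/-- The Dunkl intertwining operator. -/
def intertwinerEquiv (hn : n ≠ 0) (hk : ∀ m : ℕ, 1 ≤ m → (n : ℂ) * k ≠ -((m : ℂ) / 2)) :
    MvPolynomial (Fin 2) ℂ ≃ₗ[ℂ] MvPolynomial (Fin 2) ℂ :=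
  LinearEquiv.ofBijective (intertwiner n k)
    ⟨intertwiner_injective hn hk, intertwiner_surjective hn hk⟩

end Construction

/-! ### From polynomials to polynomial functions -/

section PolyFun

variable {d : ℕ}

/-- The complex coordinates of a real vector. -/
def complexCoords (x : EuclideanSpace ℝ (Fin d)) : Fin d → ℂ := fun i => ((x i : ℝ) : ℂ)

lemma polyFun_eq_eval (p : MvPolynomial (Fin d) ℂ) (x : EuclideanSpace ℝ (Fin d)) :
    polyFun p x = eval (complexCoords x) p := rfl

lemma polyFun_injective : Function.Injective (polyFun (d := d)) := by
  intro p q h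
  refine funext_set (fun _ => Set.range ((↑) : ℝ → ℂ))
    (hs := fun _ => Set.infinite_range_of_injective Complex.ofReal_injective) fun x hx => ?_
  choose y hy using fun i => hx i (Set.mem_univ i)
  have := congrFun h (WithLp.toLp 2 y)
  have hc : complexCoords (WithLp.toLp 2 y) = x := funext hy
  rwa [polyFun_eq_eval, polyFun_eq_eval, hc] at this

lemma hasFDerivAt_polyFun (p : MvPolynomial (Fin d) ℂ) (x : EuclideanSpace ℝ (Fin d)) :
    HasFDerivAt (polyFun p) (∑ i,
      (EuclideanSpace.proj i : EuclideanSpace ℝ (Fin d) →L[ℝ] ℝ).smulRight (polyFun (pderiv i p) x)) x := by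
  induction p using MvPolynomial.induction_on with
  | C a =>
    have : polyFun (C a : MvPolynomial (Fin d) ℂ) = fun _ => a := by
      ext x; simp [polyFun]
    rw [this]
    refine (hasFDerivAt_const a x).congr_fderiv ?_
    ext; simp [polyFun]
  | add p q hp hq =>
    have : polyFun (p + q) = polyFun p + polyFun q := by
      ext x; simp [polyFun]
    rw [this]
    refine (hp.add hq).congr_fderiv ?_
    ext ξ
    simp [polyFun, Finset.sum_add_distrib]
  | mul_X p j hp =>
    have : polyFun (p * X j) = fun x => polyFun p x * ((x j : ℝ) : ℂ) := by
      ext x; simp [polyFun]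
    rw [this]
    have hj : HasFDerivAt (fun x : EuclideanSpace ℝ (Fin d) => ((x j : ℝ) : ℂ))
        (Complex.ofRealCLM ∘L (EuclideanSpace.proj j : EuclideanSpace ℝ (Fin d) →L[ℝ] ℝ)) x :=
      (Complex.ofRealCLM ∘L (EuclideanSpace.proj j :
        EuclideanSpace ℝ (Fin d) →L[ℝ] ℝ)).hasFDerivAt
    refine (hp.fun_mul hj).congr_fderiv ?_
    ext ξ
    have h (i : Fin d) : polyFun (pderiv i (p * X j)) x =
        ((x j : ℝ) : ℂ) * polyFun (pderiv i p) x + if j = i then polyFun p x else 0 := by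
      simp only [polyFun, pderiv_mul, pderiv_X, map_add, map_mul, eval_X, Pi.single_apply]
      split_ifs <;> simp [mul_comm]
    simp only [h]
    simp [Finset.sum_add_distrib, Finset.mul_sum, mul_left_comm, mul_comm, add_comm]

lemma fderiv_polyFun (p : MvPolynomial (Fin d) ℂ) (x ξ : EuclideanSpace ℝ (Fin d)) :
    fderiv ℝ (polyFun p) x ξ = ∑ i, ((ξ i : ℝ) : ℂ) * polyFun (pderiv i p) x := by
  rw [(hasFDerivAt_polyFun p x).fderiv]
  simp

variable {α : EuclideanSpace ℝ (Fin d)}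

lemma dotProduct_complexCoords (x y : EuclideanSpace ℝ (Fin d)) :
    complexCoords x ⬝ᵥ complexCoords y = ((inner ℝ x y : ℝ) : ℂ) := by
  simp [dotProduct, complexCoords, PiLp.inner_apply, mul_comm]

lemma polyFun_linForm (α x : EuclideanSpace ℝ (Fin d)) :
    polyFun (linForm (complexCoords α)) x = ((inner ℝ α x : ℝ) : ℂ) := by
  rw [← dotProduct_complexCoords]
  simp [polyFun_eq_eval, linForm, dotProduct]

lemma polyFun_reflHom (hα : ‖α‖ = 1) (p : MvPolynomial (Fin d) ℂ)
    (x : EuclideanSpace ℝ (Fin d)) :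
    polyFun (reflHom (complexCoords α) p) x = polyFun p (rootReflection α x) := by
  have hc : complexCoords (rootReflection α x) = fun i => complexCoords x i -
      2 * complexCoords α i * ((inner ℝ α x : ℝ) : ℂ) := by
    ext i
    simp only [complexCoords, rootReflection, hα, PiLp.sub_apply, PiLp.smul_apply, smul_eq_mul,
      real_inner_comm α x]
    push_cast; ring
  have : (aeval (complexCoords x)).comp (reflHom (complexCoords α)) =
      aeval (complexCoords (rootReflection α x)) := by
    ext1 i
    have := polyFun_linForm α x
    rw [polyFun_eq_eval] at this
    simp [hc, aeval_eq_eval, this]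
  have h2 := DFunLike.congr_fun this p
  simpa [aeval_eq_eval, polyFun_eq_eval] using h2

/-- Off the hyperplane this is division. On it, differentiate `⟨α, ·⟩ D = p - p ∘ σ_α` along `α`,
with `D` the divided difference: the left side gives `D(x)` because `⟨α, x⟩ = 0` and `|α| = 1`, the
right side `2 ∂_α p(x)` because `σ_α` fixes `x` and reverses `α`. -/
lemma reflectionQuotient_polyFun (hα : ‖α‖ = 1) (p : MvPolynomial (Fin d) ℂ)
    (x : EuclideanSpace ℝ (Fin d)) :
    reflectionQuotient α (polyFun p) x = polyFun (divDiff (complexCoords α) p) x := by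
  have hmul := linForm_mul_divDiff (complexCoords α) p
  rw [reflectionQuotient]
  split_ifs with h
  · have hfix : rootReflection α x = x := by
      simp [rootReflection, real_inner_comm, h]
    have hfun : polyFun (linForm (complexCoords α) * divDiff (complexCoords α) p) =
        fun y => polyFun p y - polyFun (reflHom (complexCoords α) p) y := by
      rw [hmul]; ext y; simp [polyFun]
    have hL : fderiv ℝ (polyFun (linForm (complexCoords α) * divDiff (complexCoords α) p)) x α =
        polyFun (divDiff (complexCoords α) p) x := by
      have h0 : eval (complexCoords x) (linForm (complexCoords α)) = 0 := by
        rw [← polyFun_eq_eval, polyFun_linForm, h, Complex.ofReal_zero]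
      have h1 : complexCoords α ⬝ᵥ complexCoords α = 1 := by
        rw [dotProduct_complexCoords, real_inner_self_eq_norm_sq, hα]; simp
      rw [fderiv_polyFun]
      simp only [polyFun_eq_eval, pderiv_mul, pderiv_linForm, map_add, map_mul, eval_C, h0,
        zero_mul, add_zero]
      simp only [← mul_assoc, ← Finset.sum_mul]
      change (complexCoords α ⬝ᵥ complexCoords α) * _ = _
      rw [h1, one_mul]
    have hR : fderiv ℝ (polyFun (reflHom (complexCoords α) p)) x α =
        -fderiv ℝ (polyFun p) x α := by
      have h1 : ∑ i, complexCoords α i * complexCoords α i = 1 := by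
        change complexCoords α ⬝ᵥ complexCoords α = 1
        rw [dotProduct_complexCoords, real_inner_self_eq_norm_sq, hα]; simp
      have h2 (q : MvPolynomial (Fin d) ℂ) :
          eval (complexCoords x) (reflHom (complexCoords α) q) = eval (complexCoords x) q := by
        rw [← polyFun_eq_eval, polyFun_reflHom hα, hfix, polyFun_eq_eval]
      rw [fderiv_polyFun, fderiv_polyFun]
      simp only [pderiv_reflHom, polyFun_eq_eval, map_sub, map_mul, map_sum, eval_C, h2]
      change ∑ i, complexCoords α i * _ = -∑ i, complexCoords α i * _
      simp only [mul_sub, Finset.sum_sub_distrib]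
      generalize hg : ∑ i, complexCoords α i * eval (complexCoords x) (pderiv i p) = D
      have : ∑ i, complexCoords α i * (2 * complexCoords α i * D) =
          2 * D * ∑ i, complexCoords α i * complexCoords α i := by
        rw [Finset.mul_sum]; exact Finset.sum_congr rfl fun i _ => by ring
      rw [this, h1]; ring
    rw [← hL, hfun, fderiv_fun_sub (hasFDerivAt_polyFun _ _).differentiableAt
      (hasFDerivAt_polyFun _ _).differentiableAt, sub_apply, hR, hα]
    push_cast; ring
  · rw [div_eq_iff (by exact_mod_cast h), ← polyFun_reflHom hα, ← polyFun_linForm]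
    simp only [polyFun_eq_eval]
    rw [← map_mul, ← map_sub, ← hmul, mul_comm]

end PolyFun

/-! ### Existence and uniqueness of the intertwiner -/

section Dihedral

variable {n : ℕ} {k : ℂ}

lemma complexCoords_dihedralRoot (n : ℕ) (j : Fin n) :
    complexCoords (dihedralRoot n j) = rootVec n (j : ℕ) := by
  ext i
  fin_cases i <;> simp [complexCoords, dihedralRoot, rootVec, rootAngle]

lemma norm_dihedralRoot (n : ℕ) (j : Fin n) : ‖dihedralRoot n j‖ = 1 := by
  have := dotProduct_complexCoords (dihedralRoot n j) (dihedralRoot n j)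
  rw [complexCoords_dihedralRoot, rootVec_dotProduct_self, real_inner_self_eq_norm_sq] at this
  have h : ‖dihedralRoot n j‖ ^ 2 = 1 := by exact_mod_cast this.symm
  exact (pow_eq_one_iff_of_nonneg (norm_nonneg _) two_ne_zero).1 h

lemma dunklOp_polyFun (n : ℕ) (k : ℂ) (ξ : EuclideanSpace ℝ (Fin 2)) (p : MvPolynomial (Fin 2) ℂ)
    (x : EuclideanSpace ℝ (Fin 2)) :
    dunklOp (dihedralRoot n) (fun _ => k) ξ (polyFun p) x =
      polyFun (∑ i, C ((ξ i : ℝ) : ℂ) * dunklPoly n k i p) x := by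
  have h (j : Fin n) : ((inner ℝ (dihedralRoot n j) ξ : ℝ) : ℂ) =
      ∑ i, complexCoords ξ i * rootVec n (j : ℕ) i := by
    rw [← dotProduct_complexCoords, complexCoords_dihedralRoot, dotProduct_comm]; rfl
  simp only [dunklOp, fderiv_polyFun, reflectionQuotient_polyFun (norm_dihedralRoot n _),
    complexCoords_dihedralRoot, dunklPoly_apply, polyFun_eq_eval, map_sum, map_mul, map_add,
    eval_C, mul_add, h, Fin.sum_univ_two, add_mul, Finset.sum_add_distrib, Finset.mul_sum]
  simp only [complexCoords]
  congr 2
  all_goals exact Finset.sum_congr rfl fun j _ => by ring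

lemma isIntertwining_iff (V : MvPolynomial (Fin 2) ℂ ≃ₗ[ℂ] MvPolynomial (Fin 2) ℂ) :
    IsIntertwining (dihedralRoot n) (fun _ => k) V ↔
      (∀ (m : ℕ) (p : MvPolynomial (Fin 2) ℂ), p.IsHomogeneous m → (V p).IsHomogeneous m) ∧
      V 1 = 1 ∧ ∀ i p, dunklPoly n k i (V p) = V (pderiv i p) := by
  have hξ (ξ : EuclideanSpace ℝ (Fin 2)) (p) : V (polyDeriv ξ p) =
      ∑ i, C ((ξ i : ℝ) : ℂ) * V (pderiv i p) := by
    simp only [polyDeriv, map_sum, ← smul_eq_C_mul, map_smul]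
  constructor
  · intro h
    refine ⟨h.homogeneous, h.map_one, fun i p => polyFun_injective ?_⟩
    ext x
    have := h.intertwines (EuclideanSpace.single i 1) p x
    rw [dunklOp_polyFun, hξ] at this
    simpa [Pi.single_apply, apply_ite] using this
  · rintro ⟨h1, h2, h3⟩
    refine ⟨h1, h2, fun ξ p x => ?_⟩
    rw [dunklOp_polyFun, hξ]
    simp only [h3]

lemma IsIntertwining.euler {V : MvPolynomial (Fin 2) ℂ ≃ₗ[ℂ] MvPolynomial (Fin 2) ℂ}
    (hV : IsIntertwining (dihedralRoot n) (fun _ => k) V) {m : ℕ} {p : MvPolynomial (Fin 2) ℂ}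
    (hp : p.IsHomogeneous m) :
    ((m : ℂ) + n * k) • V p - k • polyReflSum n (V p) = ∑ i, X i * V (pderiv i p) := by
  obtain ⟨h1, -, h3⟩ := (isIntertwining_iff V).1 hV
  rw [← sum_X_mul_dunklPoly m _ (h1 m p hp)]
  simp only [h3]

/-- By the Euler identity, `V p` is determined by the `V(∂_i p)`, which have lower degree; the
normalization `V 1 = 1` starts the induction. -/
lemma IsIntertwining.unique (hn : n ≠ 0)
    (hk : ∀ m : ℕ, 1 ≤ m → (n : ℂ) * k ≠ -((m : ℂ) / 2))
    {V W : MvPolynomial (Fin 2) ℂ ≃ₗ[ℂ] MvPolynomial (Fin 2) ℂ}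
    (hV : IsIntertwining (dihedralRoot n) (fun _ => k) V)
    (hW : IsIntertwining (dihedralRoot n) (fun _ => k) W) : V = W := by
  apply LinearEquiv.toLinearMap_injective
  refine linearMap_ext_homogeneous fun m => ?_
  induction m with
  | zero =>
    intro p hp
    rw [← totalDegree_zero_iff_isHomogeneous, totalDegree_eq_zero_iff_eq_C] at hp
    rw [hp, ← mul_one (C _), ← smul_eq_C_mul, map_smul, map_smul]
    congr 1
    exact hV.map_one.trans hW.map_one.symm
  | succ m ih =>
    intro p hp
    refine shift_injective (isDihedralFamily_reflHom hn) hn hk (Nat.le_add_left 1 m) ?_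
    refine (hV.euler hp).trans (Eq.trans ?_ (hW.euler hp).symm)
    exact Finset.sum_congr rfl fun i _ => congrArg _ (ih _ hp.pderiv)

lemma isIntertwining_intertwinerEquiv (hn : n ≠ 0)
    (hk : ∀ m : ℕ, 1 ≤ m → (n : ℂ) * k ≠ -((m : ℂ) / 2)) :
    IsIntertwining (dihedralRoot n) (fun _ => k) (intertwinerEquiv hn hk) := by
  rw [isIntertwining_iff]
  refine ⟨fun m p hp => isHomogeneous_intertwiner hp, ?_, fun i p => dunklPoly_intertwiner hn hk i p⟩
  exact intertwiner_of_isHomogeneous (m := 0) (isHomogeneous_one _ _)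

end Dihedral

/-! ### Dihedral orbits are stable under the root reflections -/

section Orbit

/-- The rotation `z ↦ z e^{iθ}` of `ℝ²`. -/
def planeRotation (θ : ℝ) (x : EuclideanSpace ℝ (Fin 2)) : EuclideanSpace ℝ (Fin 2) :=
  !₂[Real.cos θ * x 0 - Real.sin θ * x 1, Real.sin θ * x 0 + Real.cos θ * x 1]

/-- The reflection `z ↦ conj z * e^{iθ}` of `ℝ²`. -/
def planeReflection (θ : ℝ) (x : EuclideanSpace ℝ (Fin 2)) : EuclideanSpace ℝ (Fin 2) :=
  !₂[Real.cos θ * x 0 + Real.sin θ * x 1, Real.sin θ * x 0 - Real.cos θ * x 1]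

lemma planeReflection_planeRotation (a b : ℝ) (x : EuclideanSpace ℝ (Fin 2)) :
    planeReflection a (planeRotation b x) = planeReflection (a - b) x := by
  ext i
  fin_cases i <;> simp [planeReflection, planeRotation, Real.cos_sub, Real.sin_sub] <;> ring

lemma planeReflection_planeReflection (a b : ℝ) (x : EuclideanSpace ℝ (Fin 2)) :
    planeReflection a (planeReflection b x) = planeRotation (a - b) x := by
  ext i
  fin_cases i <;> simp [planeReflection, planeRotation, Real.cos_sub, Real.sin_sub] <;> ring

variable {n : ℕ}

lemma dihedralMap_inl (j : Fin n) (x : EuclideanSpace ℝ (Fin 2)) :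
    dihedralMap n (.inl j) x = planeRotation (2 * rootAngle n (j : ℕ)) x := by
  simp only [dihedralMap, planeRotation, rootAngle, Int.cast_natCast, mul_div_assoc, mul_assoc]

lemma dihedralMap_inr (j : Fin n) (x : EuclideanSpace ℝ (Fin 2)) :
    dihedralMap n (.inr j) x = planeReflection (2 * rootAngle n (j : ℕ)) x := by
  simp only [dihedralMap, planeReflection, rootAngle, Int.cast_natCast, mul_div_assoc, mul_assoc]

lemma exists_fin_two_mul_rootAngle (hn : n ≠ 0) (j : ℤ) : ∃ i : Fin n, ∃ q : ℤ,
    2 * rootAngle n j = 2 * rootAngle n (i : ℕ) + q * (2 * Real.pi) := by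
  have hn' : (n : ℤ) ≠ 0 := by exact_mod_cast hn
  have h0 := Int.emod_nonneg j hn'
  have h1 := Int.emod_lt_of_pos j (b := n) (by omega)
  refine ⟨⟨(j % n).toNat, by omega⟩, j / n, ?_⟩
  have h2 : (((j % n).toNat : ℕ) : ℤ) = j % n := Int.toNat_of_nonneg h0
  have h3 : (j : ℝ) = ((j % n : ℤ) : ℝ) + n * ((j / n : ℤ) : ℝ) := by
    exact_mod_cast (Int.emod_add_mul_ediv j n).symm
  have h4 : (n : ℝ) ≠ 0 := by exact_mod_cast hn
  rw [h2, rootAngle, rootAngle, h3]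
  field_simp

lemma planeRotation_mem_range (hn : n ≠ 0) (j : ℤ) (x : EuclideanSpace ℝ (Fin 2)) :
    planeRotation (2 * rootAngle n j) x ∈ Set.range fun g => dihedralMap n g x := by
  obtain ⟨i, q, h⟩ := exists_fin_two_mul_rootAngle hn j
  refine ⟨.inl i, ?_⟩
  simp only [dihedralMap_inl, planeRotation, h, Real.cos_add_int_mul_two_pi,
    Real.sin_add_int_mul_two_pi]

lemma planeReflection_mem_range (hn : n ≠ 0) (j : ℤ) (x : EuclideanSpace ℝ (Fin 2)) :
    planeReflection (2 * rootAngle n j) x ∈ Set.range fun g => dihedralMap n g x := by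
  obtain ⟨i, q, h⟩ := exists_fin_two_mul_rootAngle hn j
  refine ⟨.inr i, ?_⟩
  simp only [dihedralMap_inr, planeReflection, h, Real.cos_add_int_mul_two_pi,
    Real.sin_add_int_mul_two_pi]

lemma rootReflection_dihedralRoot (j : Fin n) (x : EuclideanSpace ℝ (Fin 2)) :
    rootReflection (dihedralRoot n j) x = planeReflection (2 * rootAngle n (j : ℕ)) x := by
  have hs := Real.sin_sq_add_cos_sq (rootAngle n (j : ℕ))
  have hr : dihedralRoot n j =
      !₂[-Real.sin (rootAngle n (j : ℕ)), Real.cos (rootAngle n (j : ℕ))] := by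
    simp [dihedralRoot, rootAngle]
  ext i
  rw [rootReflection, norm_dihedralRoot, hr]
  fin_cases i
  · simp [planeReflection, PiLp.inner_apply, Real.cos_two_mul', Real.sin_two_mul]
    linear_combination -x 0 * hs
  · simp [planeReflection, PiLp.inner_apply, Real.cos_two_mul', Real.sin_two_mul]
    linear_combination -x 1 * hs

lemma rootReflection_mem_orbit (hn : n ≠ 0) (j : Fin n) {x x' : EuclideanSpace ℝ (Fin 2)}
    (hx : x' ∈ Set.range fun g => dihedralMap n g x) :
    rootReflection (dihedralRoot n j) x' ∈ Set.range fun g => dihedralMap n g x := by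
  obtain ⟨g, rfl⟩ := hx
  rw [rootReflection_dihedralRoot]
  cases g with
  | inl i =>
    simp only [dihedralMap_inl]
    rw [planeReflection_planeRotation, ← mul_sub, ← rootAngle_sub]
    exact planeReflection_mem_range hn _ x
  | inr i =>
    simp only [dihedralMap_inr]
    rw [planeReflection_planeReflection, ← mul_sub, ← rootAngle_sub]
    exact planeRotation_mem_range hn _ x

lemma self_mem_orbit (hn : n ≠ 0) (x : EuclideanSpace ℝ (Fin 2)) :
    x ∈ Set.range fun g => dihedralMap n g x := by
  convert planeRotation_mem_range hn 0 x
  ext i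
  fin_cases i <;> simp [planeRotation, rootAngle]

lemma norm_pairing_le_dihedralMax {x x' : EuclideanSpace ℝ (Fin 2)}
    (hx : x' ∈ Set.range fun g => dihedralMap n g x) (y : EuclideanSpace ℂ (Fin 2)) :
    ‖pairing x' y‖ ≤ dihedralMax n x y := by
  obtain ⟨g, rfl⟩ := hx
  exact le_ciSup (f := fun g => ‖pairing (dihedralMap n g x) y‖) (Set.finite_range _).bddAbove g

end Orbit

/-! ### Growth estimate in the supremum norm on an orbit -/

section Bound

variable {n : ℕ} {k : ℂ} {O : Set (EuclideanSpace ℝ (Fin 2))}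

lemma norm_polyFun_polyReflSum_le
    (hO : ∀ j : Fin n, ∀ x ∈ O, rootReflection (dihedralRoot n j) x ∈ O)
    {p : MvPolynomial (Fin 2) ℂ} {B : ℝ} (hp : ∀ x ∈ O, ‖polyFun p x‖ ≤ B) :
    ∀ x ∈ O, ‖polyFun (polyReflSum n p) x‖ ≤ n * B := by
  intro x hx
  have : polyFun (polyReflSum n p) x =
      ∑ j : Fin n, polyFun p (rootReflection (dihedralRoot n j) x) := by
    simp only [← polyFun_reflHom (norm_dihedralRoot n _), complexCoords_dihedralRoot,
      polyReflSum_apply, polyFun_eq_eval, map_sum]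
  rw [this]
  refine (norm_sum_le_of_le _ fun j _ => hp _ (hO j x hx)).trans_eq ?_
  simp

/-- A bound, close to `1` for large `m`, for the operator `m ((m + n k) - k S)⁻¹` with respect to
the supremum norm on an orbit. -/
def shiftBound (n : ℕ) (k : ℂ) (m : ℕ) : ℝ :=
  1 + 2 * ‖n * k / (m + n * k)‖ + ‖2 * n * k / (m + 2 * n * k)‖

lemma one_le_shiftBound (n : ℕ) (k : ℂ) (m : ℕ) : 1 ≤ shiftBound n k m := by
  rw [shiftBound, add_assoc]
  exact le_add_of_nonneg_right (by positivity)

lemma tendsto_norm_div_natCast_add (c : ℂ) :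
    Filter.Tendsto (fun m : ℕ => ‖c / (m + c)‖) Filter.atTop (nhds 0) := by
  have h : Filter.Tendsto (fun m : ℕ => ‖(m : ℂ) + c‖) Filter.atTop Filter.atTop := by
    refine Filter.tendsto_atTop_mono (fun m => ?_)
      (Filter.tendsto_atTop_add_const_right _ (-‖c‖) tendsto_natCast_atTop_atTop)
    have := norm_sub_norm_le (m : ℂ) (-c)
    rw [norm_neg, sub_neg_eq_add, Complex.norm_natCast] at this
    linarith
  simp only [norm_div]
  exact h.const_div_atTop _

lemma tendsto_shiftBound (n : ℕ) (k : ℂ) :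
    Filter.Tendsto (shiftBound n k) Filter.atTop (nhds 1) := by
  have := ((tendsto_norm_div_natCast_add (n * k)).const_mul 2).const_add 1 |>.add
    (tendsto_norm_div_natCast_add (2 * n * k))
  rw [mul_zero, add_zero, add_zero] at this
  exact this

lemma norm_polyFun_shiftInv_le (hn : n ≠ 0)
    (hk : ∀ m : ℕ, 1 ≤ m → (n : ℂ) * k ≠ -((m : ℂ) / 2))
    (hO : ∀ j : Fin n, ∀ x ∈ O, rootReflection (dihedralRoot n j) x ∈ O)
    {p : MvPolynomial (Fin 2) ℂ} {B : ℝ} (hp : ∀ x ∈ O, ‖polyFun p x‖ ≤ B) {m : ℕ} (hm : 1 ≤ m) :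
    ∀ x ∈ O, ‖polyFun (shiftInv n k (fun j => (reflHom (rootVec n j)).toLinearMap) m
      ((m : ℂ) • p)) x‖ ≤ shiftBound n k m * B := by
  intro x hx
  obtain ⟨h1, h2⟩ := nonsingular hk hm
  have h3 : (m : ℂ) ≠ 0 := by exact_mod_cast (by omega : m ≠ 0)
  have h4 : (0 : ℝ) < n := by exact_mod_cast Nat.pos_of_ne_zero hn
  have h5 : (n : ℂ) ≠ 0 := by exact_mod_cast hn
  have hq := norm_polyFun_polyReflSum_le hO hp
  have hr := norm_polyFun_polyReflSum_le hO hq x hx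
  have hP : ‖polyFun (polyReflSum n (polyReflSum n p)) x / (n : ℂ) ^ 2‖ ≤ B := by
    rw [norm_div, norm_pow, Complex.norm_natCast, div_le_iff₀ (by positivity)]
    linarith
  have hQ : ‖polyFun (polyReflSum n p) x / (n : ℂ)‖ ≤ B := by
    rw [norm_div, Complex.norm_natCast, div_le_iff₀ (by positivity)]
    linarith [hq x hx]
  have hH := hp x hx
  -- Writing `m / (m + c) = 1 - c / (m + c)` in the spectral decomposition isolates the identity
  -- from two corrections of size `O(1/m)`. Since `S/n` and `S²/n²` are contractions, the
  -- accompanying projections have norm at most `2` and `1`, hence the coefficients in `shiftBound`.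
  have heq : polyFun (shiftInv n k (fun j => (reflHom (rootVec n j)).toLinearMap) m
      ((m : ℂ) • p)) x = polyFun p x - n * k / (m + n * k) *
        (polyFun p x - polyFun (polyReflSum n (polyReflSum n p)) x / (n : ℂ) ^ 2) -
        2 * n * k / (m + 2 * n * k) * ((polyFun (polyReflSum n (polyReflSum n p)) x / (n : ℂ) ^ 2 -
          polyFun (polyReflSum n p) x / (n : ℂ)) / 2) := by
    change polyFun (shiftInv n k _ m _) x = _
    rw [shiftInv_apply]
    change polyFun ((1 / (m + n * k)) • ((m : ℂ) • p - (1 / (n : ℂ) ^ 2) •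
      polyReflSum n (polyReflSum n ((m : ℂ) • p))) +
      (1 / (2 * m : ℂ)) • ((1 / (n : ℂ) ^ 2) • polyReflSum n (polyReflSum n ((m : ℂ) • p)) +
        (1 / (n : ℂ)) • polyReflSum n ((m : ℂ) • p)) +
      (1 / (2 * (m + 2 * n * k))) • ((1 / (n : ℂ) ^ 2) •
        polyReflSum n (polyReflSum n ((m : ℂ) • p)) -
        (1 / (n : ℂ)) • polyReflSum n ((m : ℂ) • p))) x = _
    simp only [map_smul, polyFun_eq_eval, map_add, map_sub, smul_eval]
    generalize eval (complexCoords x) (polyReflSum n (polyReflSum n p)) = P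
    generalize eval (complexCoords x) (polyReflSum n p) = Q
    generalize eval (complexCoords x) p = H
    have ha : (n : ℂ) * k / (m + n * k) = 1 - m * (1 / (m + n * k)) := by field_simp; ring
    have hb : 2 * (n : ℂ) * k / (m + 2 * n * k) = 1 - m * (2 * (1 / (2 * (m + 2 * n * k)))) := by
      rw [eq_sub_iff_add_eq, show (m : ℂ) * (2 * (1 / (2 * (m + 2 * n * k)))) =
        m / (m + 2 * n * k) by rw [one_div, mul_inv]; ring, ← add_div, add_comm, div_self h2]
    have hc : (1 / (2 * m : ℂ)) * m = 1 / 2 := by field_simp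
    rw [ha, hb]
    generalize 1 / ((m : ℂ) + n * k) = u
    generalize 1 / (2 * ((m : ℂ) + 2 * n * k)) = v
    linear_combination (P / n ^ 2 + Q / n) * hc
  rw [heq, shiftBound]
  generalize polyFun (polyReflSum n (polyReflSum n p)) x / (n : ℂ) ^ 2 = P at *
  generalize polyFun (polyReflSum n p) x / (n : ℂ) = Q at *
  generalize polyFun p x = H at *
  generalize (n : ℂ) * k / (m + n * k) = u
  generalize 2 * (n : ℂ) * k / (m + 2 * n * k) = v
  have e1 : ‖H - P‖ ≤ 2 * B := (norm_sub_le _ _).trans (by linarith)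
  have e2 : ‖(P - Q) / 2‖ ≤ B := by
    rw [norm_div, Complex.norm_ofNat, div_le_iff₀ two_pos]
    exact (norm_sub_le _ _).trans (by linarith)
  calc ‖H - u * (H - P) - v * ((P - Q) / 2)‖
      ≤ ‖H‖ + ‖u‖ * ‖H - P‖ + ‖v‖ * ‖(P - Q) / 2‖ := by
        rw [← norm_mul, ← norm_mul]
        exact (norm_sub_le _ _).trans (by gcongr; exact norm_sub_le _ _)
    _ ≤ B + ‖u‖ * (2 * B) + ‖v‖ * B := by gcongr
    _ = _ := by ring

lemma pairingPoly_eq_linForm (y : EuclideanSpace ℂ (Fin 2)) :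
    pairingPoly y = linForm fun i => y i := by
  simp only [pairingPoly, linForm, mul_comm]

lemma polyFun_pairingPoly (x : EuclideanSpace ℝ (Fin 2)) (y : EuclideanSpace ℂ (Fin 2)) :
    polyFun (pairingPoly y) x = pairing x y := by
  simp [polyFun, pairingPoly, pairing]

/-- All partial derivatives of a power of `⟨·, y⟩` are multiples of the preceding power, so the
Euler recursion involves a single earlier term. -/
lemma IsIntertwining.pairingPoly_pow_succ (hn : n ≠ 0)
    (hk : ∀ m : ℕ, 1 ≤ m → (n : ℂ) * k ≠ -((m : ℂ) / 2))
    {V : MvPolynomial (Fin 2) ℂ ≃ₗ[ℂ] MvPolynomial (Fin 2) ℂ}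
    (hV : IsIntertwining (dihedralRoot n) (fun _ => k) V) (m : ℕ)
    (y : EuclideanSpace ℂ (Fin 2)) :
    V (pairingPoly y ^ (m + 1)) =
      shiftInv n k (fun j => (reflHom (rootVec n j)).toLinearMap) (m + 1)
        (((m + 1 : ℕ) : ℂ) • (pairingPoly y * V (pairingPoly y ^ m))) := by
  have hp : (pairingPoly y ^ (m + 1)).IsHomogeneous (m + 1) := by
    have := (isHomogeneous_linForm fun i => y i).pow (m + 1)
    rwa [one_mul, ← pairingPoly_eq_linForm] at this
  have h := shiftInv_shift (isDihedralFamily_reflHom hn) hn hk (Nat.le_add_left 1 m)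
    (V (pairingPoly y ^ (m + 1)))
  rw [← h]
  congr 1
  refine (hV.euler hp).trans ?_
  have hd (i : Fin 2) : pderiv i (pairingPoly y ^ (m + 1)) =
      (((m + 1 : ℕ) : ℂ) * y i) • pairingPoly y ^ m := by
    rw [pderiv_pow, pairingPoly_eq_linForm, pderiv_linForm, smul_eq_C_mul, C_mul]
    simp only [map_natCast, Nat.add_sub_cancel]
    ring
  simp only [hd, map_smul]
  generalize V (pairingPoly y ^ m) = q
  simp only [smul_eq_C_mul, C_mul]
  rw [pairingPoly_eq_linForm, linForm, Finset.sum_mul, Finset.mul_sum]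
  exact Finset.sum_congr rfl fun i _ => by ring

lemma IsIntertwining.norm_polyFun_pairingPoly_pow_le (hn : n ≠ 0)
    (hk : ∀ m : ℕ, 1 ≤ m → (n : ℂ) * k ≠ -((m : ℂ) / 2))
    {V : MvPolynomial (Fin 2) ℂ ≃ₗ[ℂ] MvPolynomial (Fin 2) ℂ}
    (hV : IsIntertwining (dihedralRoot n) (fun _ => k) V)
    (hO : ∀ j : Fin n, ∀ x ∈ O, rootReflection (dihedralRoot n j) x ∈ O)
    (y : EuclideanSpace ℂ (Fin 2)) {a : ℝ} (ha : ∀ x ∈ O, ‖pairing x y‖ ≤ a) (m : ℕ) :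
    ∀ x ∈ O, ‖polyFun (V (pairingPoly y ^ m)) x‖ ≤
      (∏ j ∈ Finset.range m, shiftBound n k (j + 1)) * a ^ m := by
  induction m with
  | zero => intro x hx; simp [hV.map_one, polyFun]
  | succ m ih =>
    intro x hx
    rw [hV.pairingPoly_pow_succ hn hk]
    refine (norm_polyFun_shiftInv_le hn hk hO (B := a *
      ((∏ j ∈ Finset.range m, shiftBound n k (j + 1)) * a ^ m)) (fun z hz => ?_)
      (Nat.le_add_left 1 m) x hx).trans_eq ?_
    · rw [polyFun_eq_eval, map_mul, ← polyFun_eq_eval, ← polyFun_eq_eval, polyFun_pairingPoly,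
        norm_mul]
      exact mul_le_mul (ha z hz) (ih z hz) (norm_nonneg _) ((norm_nonneg _).trans (ha z hz))
    · rw [Finset.prod_range_succ, pow_succ]; ring

/-- From some index `J` on every factor is at most `2`; the finitely many products up to `J` are
absorbed by the constant, and the added `1` makes it positive. -/
lemma exists_prod_le_mul_two_pow {N : ℕ → ℝ} (h0 : ∀ j, 0 ≤ N j)
    (hN : Filter.Tendsto N Filter.atTop (nhds 1)) :
    ∃ C : ℝ, 0 < C ∧ ∀ m, ∏ j ∈ Finset.range m, N j ≤ C * 2 ^ m := by
  obtain ⟨J, hJ⟩ := Filter.eventually_atTop.1 (hN.eventually_le_const one_lt_two)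
  have hp (m : ℕ) : 0 ≤ ∏ j ∈ Finset.range m, N j := Finset.prod_nonneg fun j _ => h0 j
  have hs : 0 ≤ ∑ i ∈ Finset.range (J + 1), ∏ j ∈ Finset.range i, N j :=
    Finset.sum_nonneg fun i _ => hp i
  have hle (m : ℕ) (hm : m ≤ J) : ∏ j ∈ Finset.range m, N j ≤
      (1 + ∑ i ∈ Finset.range (J + 1), ∏ j ∈ Finset.range i, N j) * 2 ^ m := by
    have h1 := Finset.single_le_sum (f := fun i => ∏ j ∈ Finset.range i, N j)
      (fun i _ => hp i) (Finset.mem_range.2 (Nat.lt_succ_of_le hm))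
    have h2 : (1 : ℝ) ≤ 2 ^ m := one_le_pow₀ one_le_two
    nlinarith
  refine ⟨1 + ∑ i ∈ Finset.range (J + 1), ∏ j ∈ Finset.range i, N j, by linarith, fun m => ?_⟩
  rcases le_total m J with hm | hm
  · exact hle m hm
  · induction m, hm using Nat.le_induction with
    | base => exact hle J le_rfl
    | succ m hm ih =>
      rw [Finset.prod_range_succ, pow_succ, ← mul_assoc]
      exact mul_le_mul ih (hJ m hm) (h0 m) ((hp m).trans ih)

lemma exists_norm_dunklComponent_le (hn : n ≠ 0)
    (hk : ∀ m : ℕ, 1 ≤ m → (n : ℂ) * k ≠ -((m : ℂ) / 2)) :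
    ∃ C : ℝ, 0 < C ∧ ∀ V : MvPolynomial (Fin 2) ℂ ≃ₗ[ℂ] MvPolynomial (Fin 2) ℂ,
      IsIntertwining (dihedralRoot n) (fun _ => k) V →
      ∀ (m : ℕ) (x : EuclideanSpace ℝ (Fin 2)) (y : EuclideanSpace ℂ (Fin 2)),
        ‖dunklComponent V m x y‖ ≤ C / m.factorial * (2 * dihedralMax n x y) ^ m := by
  obtain ⟨C, hC, h⟩ := exists_prod_le_mul_two_pow (N := fun j => shiftBound n k (j + 1))
    (fun j => zero_le_one.trans (one_le_shiftBound _ _ _))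
    ((Filter.tendsto_add_atTop_iff_nat 1).2 (tendsto_shiftBound n k))
  refine ⟨C, hC, fun V hV m x y => ?_⟩
  have hb := hV.norm_polyFun_pairingPoly_pow_le hn hk
    (O := Set.range fun g => dihedralMap n g x)
    (fun j x hx => rootReflection_mem_orbit hn j hx) y
    (fun x hx => norm_pairing_le_dihedralMax hx y) m x (self_mem_orbit hn x)
  have ha : 0 ≤ dihedralMax n x y :=
    (norm_nonneg _).trans (norm_pairing_le_dihedralMax (self_mem_orbit hn x) y)
  rw [dunklComponent, norm_mul, norm_div, norm_one, Complex.norm_natCast, mul_pow]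
  calc _ ≤ 1 / (m.factorial : ℝ) * (C * 2 ^ m * dihedralMax n x y ^ m) := by
        gcongr
        exact hb.trans (by gcongr; exact h m)
    _ = _ := by ring

end Bound

end

end DunklDihedral

theorem mainTheorem3 (n : ℕ) (hn : 2 ≤ n) (k : ℂ)
    (hk : ∀ m : ℕ, 1 ≤ m → (n : ℂ) * k ≠ -((m : ℂ) / 2))
    (ν : ℕ) (hν : -(ν : ℝ) < ((n : ℂ) * k).re) :
    (∃! V : MvPolynomial (Fin 2) ℂ ≃ₗ[ℂ] MvPolynomial (Fin 2) ℂ,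
      DunklDihedral.IsIntertwining (DunklDihedral.dihedralRoot n) (fun _ => k) V) ∧
    ∃ δ : ℝ, 1 ≤ δ ∧ ∃ C : ℝ, 0 < C ∧
      ∀ V : MvPolynomial (Fin 2) ℂ ≃ₗ[ℂ] MvPolynomial (Fin 2) ℂ,
        DunklDihedral.IsIntertwining (DunklDihedral.dihedralRoot n) (fun _ => k) V →
        ∀ m : ℕ, 1 ≤ m →
          ∀ (x : EuclideanSpace ℝ (Fin 2)) (y : EuclideanSpace ℂ (Fin 2)),
            ‖DunklDihedral.dunklComponent V m x y‖ ≤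
              C * ((m : ℝ) ^ (ν + 2) / (m.factorial : ℝ)) *
                (δ * DunklDihedral.dihedralMax n x y) ^ m := by
  have hn0 : n ≠ 0 := by omega
  -- The witness `δ = 2` is the base of the geometric bound; any fixed number above `1` would serve,
  -- since the factors tend to `1`.
  refine ⟨⟨DunklDihedral.intertwinerEquiv hn0 hk,
    DunklDihedral.isIntertwining_intertwinerEquiv hn0 hk, fun W hW =>
      hW.unique hn0 hk (DunklDihedral.isIntertwining_intertwinerEquiv hn0 hk)⟩, 2, one_le_two, ?_⟩
  obtain ⟨C, hC, h⟩ := DunklDihedral.exists_norm_dunklComponent_le hn0 hk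
  refine ⟨C, hC, fun V hV m hm x y => (h V hV m x y).trans ?_⟩
  have ha : 0 ≤ DunklDihedral.dihedralMax n x y := (norm_nonneg _).trans
    (DunklDihedral.norm_pairing_le_dihedralMax (DunklDihedral.self_mem_orbit hn0 x) y)
  -- The estimate already holds without the power of `m`, which only has to be at least `1`.
  have h1 : (1 : ℝ) ≤ (m : ℝ) ^ (ν + 2) := one_le_pow₀ (by exact_mod_cast hm)
  rw [← mul_div_assoc]
  gcongr
  exact le_mul_of_one_le_right hC.le h1
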